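/- All graphs are finite, simple and undirected. For a graph $G$ and $S\subseteq V(G)$, let $c(G-S)$ denote the number of connected components of the subgraph $G-S$ induced by $V(G)\setminus S$. For real $t\ge 0$, $G$ is *$t$-tough* if $|S|\ge t\cdot c(G-S)$ for every $S\subseteq V(G)$ with $c(G-S)\ge 2$. $G$ is *$2K_2$-free* if it has no induced subgraph isomorphic to the disjoint union of two copies of $K_2$. A *spanning 2-trail* of $G$ is a closed walk in $G$ that repeats no edge, visits every vertex of $G$ at least once, and visits each vertex at most twice (the coinciding start and end of the walk count as one visit). **Theorem.** Let $G$ be a $\tfrac32$-tough $2K_2$-free graph with at least three vertices. Then $G$ has a spanning 2-trail, and $G$ has a connected spanning subgraph in which every vertex has even degree at most $4$. -/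

import Mathlib

namespace SimpleGraph

/-- `G` is `2K₂`-free: it has no induced subgraph isomorphic to the disjoint union of two
copies of `K₂`. -/
def IsTwoKTwoFree {V : Type*} (G : SimpleGraph V) : Prop :=
  ¬ ((⊤ : SimpleGraph (Fin 2)) ⊕g (⊤ : SimpleGraph (Fin 2))).IsIndContained G

/-- The number of connected components of `G - S`. -/
noncomputable def numComponentsDelete {V : Type*} (G : SimpleGraph V) (S : Set V) : ℕ :=
  Nat.card (G.induce Sᶜ).ConnectedComponent

/-- A (finite) graph `G` is `t`-tough if `|S| ≥ t · c(G - S)` for every set `S` of vertices with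
`c(G - S) ≥ 2`. -/
def IsTough {V : Type*} (G : SimpleGraph V) (t : ℝ) : Prop :=
  ∀ S : Set V, 2 ≤ G.numComponentsDelete S → t * (G.numComponentsDelete S : ℝ) ≤ (S.ncard : ℝ)

open Classical in
/-- A closed walk `v₀, v₁, …, vₙ = v₀` is a `k`-trail if it repeats no edge and visits each vertex at
most `k` times. The entries `v₀` and `vₙ` are one and the same visit, so visits are counted in
`v₁, …, vₙ`, the tail of the support. -/
def Walk.IsKTrail {V : Type*} {G : SimpleGraph V} {u : V} (p : G.Walk u u) (k : ℕ) : Prop :=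
  p.IsTrail ∧ ∀ v : V, p.support.tail.count v ≤ k

/-- `G` has a spanning `k`-trail: a `k`-trail that visits every vertex of `G`. -/
def HasSpanningKTrail {V : Type*} (G : SimpleGraph V) (k : ℕ) : Prop :=
  ∃ (u : V) (p : G.Walk u u), p.IsKTrail k ∧ ∀ v : V, v ∈ p.support

/-- `H` is a spanning Eulerian subgraph of `G` (as a graph on the same vertex set): it is connected
and all its degrees are even. -/
def IsSpanningEulerianSubgraph {V : Type*} (H G : SimpleGraph V) : Prop :=
  H ≤ G ∧ H.Connected ∧ ∀ v : V, Even (H.neighborSet v).ncard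

end SimpleGraph

/-! It suffices to find a connected spanning subgraph `H` of `G` with all degrees two or four. An
Euler tour of `H` then uses at most four edges at each vertex, so it visits each vertex at most
twice.

Such an `H` grows out of a 2-factor. Toughness bounds the isolated vertices and leaves of every
induced subgraph (`IsTough.two_mul_isolated_add_leaves_le`), and an uncrossing step turns this into
the Hall-type inequality `IsTough.two_mul_card_add_le`. Hall's theorem applied to arcs gives a 2-in
2-out digraph, that is, a half-integral fractional 2-factor. Its half edges form an even graph with
an even number of edges. Alternating along an even Euler tour, or along two odd tours joined by an
edge that `2K₂`-freeness provides, removes half edges until none is left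
(`IsHalfFactor.exists_improvement`).

Next, take a spanning subgraph with degrees two or four in which one component is as large as
possible, subject to all degrees outside it being two. If it is disconnected, no local exchange
merges that component with another. By `2K₂`-freeness, the neighborhood of an outside edge then
meets every edge of the large component in exactly one end (`Unmergeable.adj_or_adj_iff_not`). If
the large component is 2-regular, propagating this alternation along both components gives a
contradiction (`Unmergeable.false_of_deg_eq_two`). If it has a vertex of degree four, all outside
edges induce the same bipartition of it. One side is then isolated once the other, no larger side is
deleted, against toughness (`IsTough.exists_not_unmergeable`). -/

namespace SimpleGraph

/-- The degree of a vertex, as the cardinality of its neighbor set. -/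
noncomputable def deg {V : Type*} (H : SimpleGraph V) (v : V) : ℕ := (H.neighborSet v).ncard

/-! ### Degrees under edge exchange, and parity -/

section Degrees

variable {V : Type*}

theorem deg_eq_degree (H : SimpleGraph V) (v : V) [Fintype (H.neighborSet v)] :
    H.deg v = H.degree v := by
  rw [deg, Set.ncard_eq_toFinset_card', Set.toFinset_card, card_neighborSet_eq_degree]

variable [Finite V]

theorem deg_pos_iff {H : SimpleGraph V} {v : V} : 0 < H.deg v ↔ ∃ w, H.Adj v w := by
  rw [deg, Set.ncard_pos (Set.toFinite _)]; rfl

open Classical in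
theorem deg_sup_edge {H : SimpleGraph V} {a b : V} (hne : a ≠ b) (h : ¬ H.Adj a b) (v : V) :
    (H ⊔ edge a b).deg v = H.deg v + (if v = a then 1 else 0) + (if v = b then 1 else 0) := by
  unfold deg
  by_cases ha : v = a
  · subst ha
    have : (H ⊔ edge v b).neighborSet v = insert b (H.neighborSet v) := by
      ext w; simp [edge_adj]; grind
    rw [this, Set.ncard_insert_of_notMem (by simpa using h)]
    simp [hne]
  · by_cases hb : v = b
    · subst hb
      have : (H ⊔ edge a v).neighborSet v = insert a (H.neighborSet v) := by
        ext w; simp [edge_adj]; grind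
      rw [this, Set.ncard_insert_of_notMem (by simpa using fun h' => h h'.symm)]
      simp [ha]
    · have : (H ⊔ edge a b).neighborSet v = H.neighborSet v := by
        ext w; simp [edge_adj]; grind
      simp [this, ha, hb]

open Classical in
theorem deg_sdiff_edge {H : SimpleGraph V} {a b : V} (h : H.Adj a b) (v : V) :
    (H \ edge a b).deg v + (if v = a then 1 else 0) + (if v = b then 1 else 0) = H.deg v := by
  have h1 : (H \ edge a b) ⊔ edge a b = H := by
    refine sdiff_sup_cancel ?_
    exact (edge_le_iff _).2 (Or.inr h)
  conv_rhs => rw [← h1]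
  rw [deg_sup_edge h.ne]
  simp [edge_adj, h.ne]

/-- A vertex of odd degree is joined to another vertex of odd degree. -/
theorem reachable_of_unique_odd {L : SimpleGraph V} {z w : V} (hz : Odd (L.deg z))
    (h : ∀ v, v ≠ z → v ≠ w → Even (L.deg v)) : L.Reachable z w := by
  classical
  have := Fintype.ofFinite V
  -- `K` keeps only the component of `z`. The handshake lemma in `K` gives a second odd vertex,
  -- which must lie in that component.
  let K : SimpleGraph V :=
    { Adj := fun a b => L.Adj a b ∧ L.Reachable z a
      symm := ⟨fun a b h => ⟨h.1.symm, h.2.trans h.1.reachable⟩⟩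
      loopless := ⟨fun a h => L.loopless.irrefl a h.1⟩ }
  have hK : ∀ v, L.Reachable z v → K.deg v = L.deg v := by
    intro v hv
    have : K.neighborSet v = L.neighborSet v := by
      ext w; simp [K, hv]
    simp [deg, this]
  have hK0 : ∀ v, ¬ L.Reachable z v → K.deg v = 0 := by
    intro v hv
    have : K.neighborSet v = ∅ := by
      ext w; simp [K, hv]
    simp [deg, this]
  obtain ⟨y, hyz, hy⟩ := K.exists_ne_odd_degree_of_exists_odd_degree z
    (by rw [← deg_eq_degree, hK z (Reachable.refl z)]; exact hz)
  rw [← deg_eq_degree] at hy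
  by_cases hr : L.Reachable z y
  · rw [hK y hr] at hy
    by_cases hyw : y = w
    · exact hyw ▸ hr
    · exact absurd (h y hyz hyw) (Nat.not_even_iff_odd.2 hy)
  · rw [hK0 y hr] at hy
    exact absurd hy (by decide)

open Classical in
/-- An edge of a graph with all degrees even is not a bridge. -/
theorem reachable_sdiff_edge_of_even {H : SimpleGraph V} (heven : ∀ v, Even (H.deg v)) {a b : V}
    (h : H.Adj a b) : (H \ edge a b).Reachable a b := by
  have hd := deg_sdiff_edge h
  apply reachable_of_unique_odd
  · have h1 := hd a
    have h2 := heven a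
    simp [h.ne] at h1
    rw [← h1] at h2
    exact (Nat.even_add_one.1 h2) |> Nat.not_even_iff_odd.1
  · intro v ha hb
    have h1 := hd v
    simp [ha, hb] at h1
    rw [h1]; exact heven v

end Degrees

/-! ### Euler tours and `k`-trails -/

section Euler

variable {V : Type*}

open Classical in
theorem Walk.IsTrail.ncard_setOf_mem_edges {H : SimpleGraph V} {u w : V} {p : H.Walk u w}
    (hp : p.IsTrail) (v : V) :
    {x | s(v, x) ∈ p.edges}.ncard = p.edges.countP (fun e => v ∈ e) := by
  have h1 : (fun x => s(v, x)) '' {x | s(v, x) ∈ p.edges}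
      = ((p.edges.filter (fun e => v ∈ e)).toFinset : Set (Sym2 V)) := by
    ext e
    simp only [Set.mem_image, Set.mem_ofPred_eq, List.coe_toFinset, List.mem_filter,
      decide_eq_true_eq]
    constructor
    · rintro ⟨x, hx, rfl⟩; exact ⟨hx, by simp⟩
    · rintro ⟨he, hv⟩
      obtain ⟨x, rfl⟩ := Sym2.mem_iff_exists.1 hv
      exact ⟨x, he, rfl⟩
  have h2 : Function.Injective (fun x => s(v, x)) := by
    intro x y hxy
    exact Sym2.congr_right.1 hxy
  rw [← Set.ncard_image_of_injective _ h2, h1, Set.ncard_coe_finset,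
    List.toFinset_card_of_nodup (hp.edges_nodup.filter _), List.countP_eq_length_filter]

variable [Finite V]

theorem even_deg_deleteEdges_trail {H : SimpleGraph V} (heven : ∀ v, Even (H.deg v)) {u : V}
    {p : H.Walk u u} (hp : p.IsTrail) (v : V) :
    Even ((H.deleteEdges {e | e ∈ p.edges}).deg v) := by
  classical
  have h1 : (H.deleteEdges {e | e ∈ p.edges}).neighborSet v
      = H.neighborSet v \ {x | s(v, x) ∈ p.edges} := by
    ext x; simp
  have hsub : {x | s(v, x) ∈ p.edges} ⊆ H.neighborSet v := by
    intro x hx; exact p.adj_of_mem_edges hx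
  have h2 := Set.ncard_sdiff_add_ncard_of_subset hsub (Set.toFinite _)
  have h3 : Even ({x | s(v, x) ∈ p.edges}.ncard) := by
    rw [hp.ncard_setOf_mem_edges v]
    exact (hp.even_countP_edges_iff v).2 (by simp)
  unfold deg
  rw [h1]
  have h4 : Even (H.neighborSet v).ncard := heven v
  rw [← h2, Nat.even_add] at h4
  exact h4.2 h3

/-- By connectivity some unused edge leaves a vertex `w` of the trail. The unused edges form an even
graph, so this edge is not a bridge there and lies on a closed trail through `w`, which is spliced
in at `w`. -/
theorem exists_longer_closed_trail {H : SimpleGraph V} (heven : ∀ v, Even (H.deg v)) {u : V}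
    {p : H.Walk u u} (hp : p.IsTrail) {a b : V} (ha : H.Reachable u a) (hab : H.Adj a b)
    (he : s(a, b) ∉ p.edges) : ∃ q : H.Walk u u, q.IsTrail ∧ p.length < q.length := by
  classical
  obtain ⟨w, z, hw, hwz, hwp⟩ :
      ∃ w z, w ∈ p.support ∧ H.Adj w z ∧ s(w, z) ∉ p.edges := by
    by_contra! hcon
    have hcl : ∀ a, H.Reachable u a → a ∈ p.support := by
      rintro a ⟨q⟩
      have : ∀ {x y : V} (q : H.Walk x y), x ∈ p.support → y ∈ p.support := by
        intro x y q
        induction q with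
        | nil => exact id
        | cons h q ih => exact fun hx => ih (p.snd_mem_support_of_mem_edges (hcon _ _ hx h))
      exact this q p.start_mem_support
    exact he (hcon a b (hcl a ha) hab)
  set K := H.deleteEdges {e | e ∈ p.edges} with hK
  have hKH : K ≤ H := deleteEdges_le _
  have hKwz : K.Adj w z := by simp [hK, hwz, hwp]
  have hKe : ∀ v, Even (K.deg v) := even_deg_deleteEdges_trail heven hp
  obtain ⟨r, hr⟩ := (reachable_sdiff_edge_of_even hKe hKwz).symm.exists_isPath
  have hle : K \ edge w z ≤ K := sdiff_le
  let c : K.Walk w w := Walk.cons hKwz (r.mapLe hle)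
  have hc : c.IsTrail := by
    rw [Walk.isTrail_cons]
    refine ⟨(Walk.isTrail_mapLe hle).2 hr.isTrail, ?_⟩
    rw [Walk.edges_mapLe_eq_edges]
    intro hmem
    have := r.adj_of_mem_edges hmem
    simp [edge_adj, hwz.ne] at this
  let c' : H.Walk w w := c.mapLe hKH
  have hc' : c'.IsTrail := (Walk.isTrail_mapLe hKH).2 hc
  have hdis : ∀ e, e ∈ c'.edges → e ∉ p.edges := by
    intro e he' hep
    rw [Walk.edges_mapLe_eq_edges] at he'
    have := c.edges_subset_edgeSet he'
    rw [hK, edgeSet_deleteEdges] at this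
    exact this.2 hep
  refine ⟨(p.takeUntil w hw).append (c'.append (p.dropUntil w hw)), ?_, ?_⟩
  · rw [Walk.isTrail_def, Walk.edges_append, Walk.edges_append]
    have hspec : (p.takeUntil w hw).edges ++ (p.dropUntil w hw).edges = p.edges := by
      rw [← Walk.edges_append, Walk.take_spec]
    have hnd := hp.edges_nodup
    rw [← hspec] at hnd
    rw [List.nodup_append] at hnd
    have hmem : ∀ e, e ∈ (p.takeUntil w hw).edges ∨ e ∈ (p.dropUntil w hw).edges → e ∈ p.edges := by
      intro e he'; rw [← hspec]; exact List.mem_append.2 he'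
    rw [List.nodup_append]
    refine ⟨hnd.1, ?_, ?_⟩
    · rw [List.nodup_append]
      refine ⟨hc'.edges_nodup, hnd.2.1, ?_⟩
      rintro e h1 f h2 rfl
      exact hdis e h1 (hmem e (Or.inr h2))
    · rintro e h1 f h2 rfl
      rcases List.mem_append.1 h2 with h2 | h2
      · exact hdis e h2 (hmem e (Or.inl h1))
      · exact hnd.2.2 e h1 e h2 rfl
  · have hlen : (p.takeUntil w hw).length + (p.dropUntil w hw).length = p.length := by
      rw [← Walk.length_append, Walk.take_spec]
    have : 0 < c'.length := by rw [Walk.length_map, Walk.length_cons]; omega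
    simp only [Walk.length_append]
    omega

/-- **Euler's theorem**: in a finite graph with all degrees even, there is a closed trail through
all edges of a given component. -/
theorem exists_closed_trail_covering {H : SimpleGraph V} (heven : ∀ v, Even (H.deg v)) (u : V) :
    ∃ p : H.Walk u u, p.IsTrail ∧ ∀ a b, H.Reachable u a → H.Adj a b → s(a, b) ∈ p.edges := by
  classical
  have := Fintype.ofFinite V
  have hbdd : ∀ n, (∃ p : H.Walk u u, p.IsTrail ∧ p.length = n) → n ≤ H.edgeFinset.card := by
    rintro n ⟨p, hp, rfl⟩
    exact hp.length_le_card_edgeFinset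
  obtain ⟨p, hp, hlen⟩ := Nat.findGreatest_spec (P := fun n => ∃ p : H.Walk u u, p.IsTrail ∧
    p.length = n) (Nat.zero_le H.edgeFinset.card) ⟨Walk.nil, by simp, rfl⟩
  refine ⟨p, hp, fun a b ha hab => ?_⟩
  by_contra he
  obtain ⟨q, hq, hpq⟩ := exists_longer_closed_trail heven hp ha hab he
  have := Nat.le_findGreatest (P := fun n => ∃ p : H.Walk u u, p.IsTrail ∧ p.length = n)
    (hbdd _ ⟨q, hq, rfl⟩) ⟨q, hq, rfl⟩
  omega

/-- A closed trail in a graph of maximum degree at most `2 * k` is a `k`-trail. -/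
theorem Walk.IsTrail.isKTrail {H : SimpleGraph V} {u : V} {p : H.Walk u u} (hp : p.IsTrail) {k : ℕ}
    (hdeg : ∀ v, H.deg v ≤ 2 * k) : p.IsKTrail k := by
  classical
  refine ⟨hp, fun v => ?_⟩
  -- Each edge at `v` either enters or leaves `v`. On a closed walk the two counts agree, so the
  -- trail uses exactly twice as many edges at `v` as it makes visits.
  have key : ∀ {x y : V} (q : H.Walk x y), q.edges.countP (fun e => v ∈ e)
      = q.support.tail.count v + q.support.dropLast.count v := by
    intro x y q
    rw [← Walk.map_snd_darts, ← Walk.map_fst_darts, Walk.edges]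
    generalize q.darts = l
    induction l with
    | nil => simp
    | cons d l ih =>
      have hne := d.adj.ne
      simp only [List.map_cons, List.countP_cons, List.count_cons, ih, Dart.edge]
      obtain ⟨⟨a, b⟩, h⟩ := d
      simp only at hne ⊢
      simp only [Sym2.mem_iff, beq_iff_eq, decide_eq_true_eq]
      grind
  have hsame : p.support.tail.count v = p.support.dropLast.count v := by
    cases p with
    | nil => simp
    | cons h q =>
      have h1 : (Walk.cons h q).support = (Walk.cons h q).support.dropLast ++ [u] := by
        conv_lhs => rw [← List.dropLast_append_getLast (Walk.support_ne_nil _)]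
        simp
      have h2 := congrArg (List.count v) h1
      have h3 := congrArg (List.count v) (Walk.cons_tail_support (Walk.cons h q))
      simp only [List.count_append, List.count_cons, List.count_nil] at h2 h3
      omega
  have h1 := hp.ncard_setOf_mem_edges v
  rw [key p, ← hsame] at h1
  have hsub : {x | s(v, x) ∈ p.edges} ⊆ H.neighborSet v := by
    intro x hx; exact p.adj_of_mem_edges hx
  have h2 := Set.ncard_le_ncard hsub (Set.toFinite _)
  have h3 := hdeg v
  unfold deg at h3
  convert (show p.support.tail.count v ≤ k by omega)

theorem hasSpanningKTrail_of_le {H G : SimpleGraph V} (hle : H ≤ G) (hconn : H.Connected)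
    (heven : ∀ v, Even (H.deg v)) {k : ℕ} (hdeg : ∀ v, H.deg v ≤ 2 * k)
    (hpos : ∀ v, 0 < H.deg v) : G.HasSpanningKTrail k := by
  obtain ⟨u⟩ := hconn.nonempty
  obtain ⟨p, hp, hcov⟩ := exists_closed_trail_covering heven u
  have hk := hp.isKTrail hdeg
  refine ⟨u, p.mapLe hle, ⟨(Walk.isTrail_mapLe hle).2 hp, fun v => ?_⟩, fun v => ?_⟩
  · have := hk.2 v
    rw [Walk.support_mapLe_eq_support]
    exact this
  · rw [Walk.support_mapLe_eq_support]
    obtain ⟨w, hw⟩ := deg_pos_iff.1 (hpos v)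
    exact p.fst_mem_support_of_mem_edges (hcov v w (hconn.preconnected u v) hw)

end Euler

end SimpleGraph

namespace SimpleGraph

/-! ### From toughness to a fractional 2-factor condition -/

section Toughness

variable {V : Type*} {G : SimpleGraph V}

theorem IsTwoKTwoFree.exists_adj (hG : G.IsTwoKTwoFree) {a b c d : V} (hab : G.Adj a b)
    (hcd : G.Adj c d) (hac : a ≠ c) (had : a ≠ d) (hbc : b ≠ c) (hbd : b ≠ d) :
    G.Adj a c ∨ G.Adj a d ∨ G.Adj b c ∨ G.Adj b d := by
  by_contra! hcon
  obtain ⟨h1, h2, h3, h4⟩ := hcon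
  refine hG ⟨⟨⟨Sum.elim ![a, b] ![c, d], ?_⟩, ?_⟩⟩
  · rintro (i | i) (j | j) <;> fin_cases i <;> fin_cases j <;>
      simp [hac, had, hbc, hbd, hac.symm, had.symm, hbc.symm, hbd.symm, hab.ne, hab.ne.symm,
        hcd.ne, hcd.ne.symm]
  · intro x y
    change G.Adj (Sum.elim ![a, b] ![c, d] x) (Sum.elim ![a, b] ![c, d] y) ↔ _
    revert x y
    rintro (i | i) (j | j) <;> fin_cases i <;> fin_cases j <;>
      simp [hab, hab.symm, hcd, hcd.symm, h1, h2, h3, h4, G.adj_comm c, G.adj_comm d,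
        SimpleGraph.sum]

open Classical in
/-- The number of neighbors of `x` in `W`. -/
noncomputable def degIn (G : SimpleGraph V) (W : Finset V) (x : V) : ℕ :=
  (W.filter (G.Adj x)).card

theorem degIn_eq_zero {W : Finset V} {x w : V} (h : G.degIn W x = 0) (hw : w ∈ W) :
    ¬ G.Adj x w := by
  classical
  intro hx
  rw [degIn, Finset.card_eq_zero] at h
  exact Finset.notMem_empty w (h ▸ Finset.mem_filter.2 ⟨hw, hx⟩)

theorem eq_of_degIn_eq_one {W : Finset V} {x w w' : V} (h : G.degIn W x = 1) (hw : w ∈ W)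
    (hx : G.Adj x w) (hw' : w' ∈ W) (hx' : G.Adj x w') : w = w' := by
  classical
  exact Finset.card_le_one.1 h.le w (Finset.mem_filter.2 ⟨hw, hx⟩) w' (Finset.mem_filter.2 ⟨hw', hx'⟩)

theorem exists_of_degIn_pos {W : Finset V} {x : V} (h : 0 < G.degIn W x) :
    ∃ w ∈ W, G.Adj x w := by
  classical
  obtain ⟨w, hw⟩ := Finset.card_pos.1 h
  exact ⟨w, (Finset.mem_filter.1 hw).1, (Finset.mem_filter.1 hw).2⟩

theorem exists_ne_of_two_le_degIn {W : Finset V} {x : V} (h : 2 ≤ G.degIn W x) (a : V) :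
    ∃ w ∈ W, G.Adj x w ∧ w ≠ a := by
  classical
  obtain ⟨w, hw, hwa⟩ := Finset.exists_mem_ne (s := W.filter (G.Adj x)) h a
  exact ⟨w, (Finset.mem_filter.1 hw).1, (Finset.mem_filter.1 hw).2, hwa⟩

variable [Fintype V]

/-- The vertices of `A` are singleton components of `G - S`, and `z` lies in one more; nonemptiness
of `A` makes that at least two components. -/
theorem IsTough.three_mul_le (h : G.IsTough (3 / 2)) {S A : Finset V} {z : V} (hA : A.Nonempty)
    (hAS : ∀ a ∈ A, a ∉ S) (hN : ∀ a ∈ A, ∀ w, G.Adj a w → w ∈ S) (hz : z ∉ A) (hzS : z ∉ S) :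
    3 * (A.card + 1) ≤ 2 * S.card := by
  classical
  let f : {x // x ∈ insert z A} → (G.induce (S : Set V)ᶜ).ConnectedComponent :=
    fun x => connectedComponentMk _ ⟨x.1, by
      rcases Finset.mem_insert.1 x.2 with hx | hx
      · rw [hx]; simpa using hzS
      · simpa using hAS _ hx⟩
  have key : ∀ x y : ((S : Set V)ᶜ : Set V), x.1 ∈ A → (G.induce (S : Set V)ᶜ).Reachable x y →
      x = y := by
    rintro x y hx ⟨p⟩
    cases p with
    | nil => rfl
    | @cons _ v _ hadj q => exact absurd (hN _ hx _ hadj) (by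
      have := v.2
      rwa [Set.mem_compl_iff, Finset.mem_coe] at this)
  have hf : Function.Injective f := by
    rintro ⟨x, hx⟩ ⟨y, hy⟩ hxy
    have hr := ConnectedComponent.exact hxy
    rw [Subtype.mk.injEq]
    rcases Finset.mem_insert.1 hx with hx' | hx'
    · rcases Finset.mem_insert.1 hy with hy' | hy'
      · rw [hx', hy']
      · have := key _ _ hy' hr.symm
        simpa using (congrArg Subtype.val this).symm
    · have := key _ _ hx' hr
      simpa using (congrArg Subtype.val this)
  have hcard : A.card + 1 ≤ G.numComponentsDelete (S : Set V) := by
    have := Nat.card_le_card_of_injective f hf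
    rwa [Nat.card_eq_fintype_card, Fintype.card_coe, Finset.card_insert_of_notMem hz] at this
  have h2 := h (S : Set V) (le_trans (by have := hA.card_pos; omega) hcard)
  rw [Set.ncard_coe_finset] at h2
  have h3 : ((A.card + 1 : ℕ) : ℝ) ≤ (G.numComponentsDelete (S : Set V) : ℝ) := by
    exact_mod_cast hcard
  have : (3 * (A.card + 1) : ℝ) ≤ 2 * S.card := by push_cast at h3; linarith
  exact_mod_cast this

open Classical in
-- Deleting `Wᶜ` together with one neighbor of each leaf isolates all the vertices counted on the
-- left. This costs at most one extra vertex per leaf, which the factor 3/2 pays for. A `K₂`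
-- component of `G[W]` must be treated apart, since there the neighbor is itself a leaf.
theorem IsTough.two_mul_isolated_add_leaves_le (htough : G.IsTough (3 / 2))
    (hfree : G.IsTwoKTwoFree) (hcard : 3 ≤ Fintype.card V) {X W : Finset V} (hXW : X ⊆ W) :
    2 * (X.filter (fun x => G.degIn W x = 0)).card + (X.filter (fun x => G.degIn W x = 1)).card
      ≤ 2 * Wᶜ.card := by
  set X0 := X.filter (fun x => G.degIn W x = 0) with hX0
  set X1 := X.filter (fun x => G.degIn W x = 1) with hX1
  have hcW : W.card + Wᶜ.card = Fintype.card V := Finset.card_add_card_compl W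
  -- If `ab` is a component of `G[W]`, then `2K₂`-freeness makes every other vertex of `W` isolated
  -- in `G[W]`.
  by_cases hK : ∃ a b, a ∈ X1 ∧ b ∈ W ∧ G.Adj a b ∧ G.degIn W b = 1
  · obtain ⟨a, b, ha, hb, hab, hdb⟩ := hK
    have ha' := Finset.mem_filter.1 ha
    have haW : a ∈ W := hXW ha'.1
    have hiso : ∀ w ∈ W, w ≠ a → w ≠ b → ∀ z ∈ W, ¬ G.Adj w z := by
      intro w hw hwa hwb z hz hwz
      have hza : z ≠ a := by
        rintro rfl
        exact hwb (eq_of_degIn_eq_one ha'.2 hw hwz.symm hb hab)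
      have hzb : z ≠ b := by
        rintro rfl
        exact hwa (eq_of_degIn_eq_one hdb hw hwz.symm haW hab.symm)
      rcases hfree.exists_adj hab hwz hwa.symm hza.symm hwb.symm hzb.symm with h | h | h | h
      · exact hwb (eq_of_degIn_eq_one ha'.2 hw h hb hab)
      · exact hzb (eq_of_degIn_eq_one ha'.2 hz h hb hab)
      · exact hwa (eq_of_degIn_eq_one hdb hw h haW hab.symm)
      · exact hza (eq_of_degIn_eq_one hdb hz h haW hab.symm)
    have hX1c : X1.card ≤ 2 := by
      refine le_trans (Finset.card_le_card (t := {a, b}) ?_) Finset.card_le_two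
      intro x hx
      have hx' := Finset.mem_filter.1 hx
      by_contra hxab
      simp only [Finset.mem_insert, Finset.mem_singleton, not_or] at hxab
      obtain ⟨w, hw, hxw⟩ := exists_of_degIn_pos (show 0 < G.degIn W x by omega)
      exact hiso x (hXW hx'.1) hxab.1 hxab.2 w hw hxw
    have hX0c : X0 ⊆ (W.erase a).erase b := by
      intro x hx
      have hx' := Finset.mem_filter.1 hx
      refine Finset.mem_erase.2 ⟨?_, Finset.mem_erase.2 ⟨?_, hXW hx'.1⟩⟩
      · rintro rfl; omega
      · rintro rfl; omega
    have hX0c' := Finset.card_le_card hX0c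
    have hcA : ((W.erase a).erase b).card + 2 = W.card := by
      rw [Finset.card_erase_of_mem (Finset.mem_erase.2 ⟨hab.ne.symm, hb⟩),
        Finset.card_erase_of_mem haW]
      have : 2 ≤ W.card := Finset.one_lt_card.2 ⟨a, haW, b, hb, hab.ne⟩
      omega
    by_cases hA : ((W.erase a).erase b).Nonempty
    · have := htough.three_mul_le (S := Wᶜ) (z := a) hA (by simp) (by
        intro x hx w hxw
        simp only [Finset.mem_erase] at hx
        by_contra hw
        exact hiso x hx.2.2 hx.2.1 hx.1 w (by simpa using hw) hxw) (by simp) (by simpa using haW)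
      omega
    · rw [Finset.not_nonempty_iff_eq_empty] at hA
      rw [hA] at hcA hX0c'
      simp only [Finset.card_empty] at hcA hX0c'
      omega
  · push Not at hK
    have hb : ∀ a, ∃ b, a ∈ X1 → b ∈ W ∧ G.Adj a b ∧ 2 ≤ G.degIn W b := by
      intro a
      by_cases ha : a ∈ X1
      · have ha' := Finset.mem_filter.1 ha
        obtain ⟨b, hb, hab⟩ := exists_of_degIn_pos (show 0 < G.degIn W a by omega)
        refine ⟨b, fun _ => ⟨hb, hab, ?_⟩⟩
        have h1 := hK a b ha hb hab
        have h0 : G.degIn W b ≠ 0 := fun h => degIn_eq_zero h (hXW ha'.1) hab.symm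
        omega
      · exact ⟨a, fun h => absurd h ha⟩
    choose b hb using hb
    set Z := X1.image b with hZ
    have hZc : Z.card ≤ X1.card := Finset.card_image_le
    set A := X0 ∪ X1 with hA
    have hdisj : Disjoint X0 X1 := by
      rw [Finset.disjoint_left]
      intro x h0 h1
      have := (Finset.mem_filter.1 h0).2
      have := (Finset.mem_filter.1 h1).2
      omega
    have hAc : A.card = X0.card + X1.card := Finset.card_union_of_disjoint hdisj
    set S := Wᶜ ∪ Z with hS
    have hSc : S.card ≤ Wᶜ.card + Z.card := Finset.card_union_le _ _
    have hAd : ∀ a ∈ A, a ∈ W ∧ G.degIn W a ≤ 1 := by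
      intro a ha
      rcases Finset.mem_union.1 ha with ha | ha
      · exact ⟨hXW (Finset.mem_filter.1 ha).1, by have := (Finset.mem_filter.1 ha).2; omega⟩
      · exact ⟨hXW (Finset.mem_filter.1 ha).1, by have := (Finset.mem_filter.1 ha).2; omega⟩
    have hZd : ∀ z ∈ Z, z ∈ W ∧ 2 ≤ G.degIn W z := by
      intro z hz
      obtain ⟨a, ha, rfl⟩ := Finset.mem_image.1 hz
      exact ⟨(hb a ha).1, (hb a ha).2.2⟩
    have hAS : ∀ a ∈ A, a ∉ S := by
      intro a ha haS
      rcases Finset.mem_union.1 haS with h | h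
      · exact (Finset.mem_compl.1 h) (hAd a ha).1
      · have := (hAd a ha).2
        have := (hZd a h).2
        omega
    have hN : ∀ a ∈ A, ∀ w, G.Adj a w → w ∈ S := by
      intro a ha w haw
      by_cases hw : w ∈ W
      · rcases Finset.mem_union.1 ha with h | h
        · exact absurd haw (degIn_eq_zero (Finset.mem_filter.1 h).2 hw)
        · have := eq_of_degIn_eq_one (Finset.mem_filter.1 h).2 hw haw (hb a h).1 (hb a h).2.1
          exact Finset.mem_union_right _ (Finset.mem_image.2 ⟨a, h, this.symm⟩)
      · exact Finset.mem_union_left _ (Finset.mem_compl.2 hw)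
    rcases Finset.eq_empty_or_nonempty A with hAe | hAne
    · rw [hAe, Finset.card_empty] at hAc
      omega
    -- Toughness needs a component beyond those counted. Without a spare vertex of `W`, one element
    -- of `A` plays this role, unless `A` is a singleton.
    by_cases hz : ∃ z ∈ W, z ∉ A ∧ z ∉ Z
    · obtain ⟨z, hzW, hzA, hzZ⟩ := hz
      have := htough.three_mul_le hAne hAS hN hzA (by simp [hS, hzW, hzZ])
      omega
    · push Not at hz
      by_cases hA1 : A.card = 1
      · obtain ⟨a, hAa⟩ := Finset.card_eq_one.1 hA1
        have haA : a ∈ A := by simp [hAa]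
        rcases Finset.mem_union.1 haA with ha | ha
        · have hX1 : X1 = ∅ := by
            rw [← Finset.card_eq_zero]
            have := Finset.card_pos.2 ⟨a, ha⟩
            omega
          have hWa : W ⊆ {a} := by
            intro w hw
            by_contra hwa
            have := hz w hw (by rw [hAa]; exact hwa)
            rw [hZ, hX1] at this
            simp at this
          have := Finset.card_le_card hWa
          rw [Finset.card_singleton] at this
          rw [hX1, Finset.card_empty] at *
          omega
        · obtain ⟨w, hw, hbw, hwa⟩ := exists_ne_of_two_le_degIn (hb a ha).2.2 a
          have hX1a : X1 ⊆ {a} := hAa ▸ Finset.subset_union_right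
          have hwZ := hz w hw (by rw [hAa]; simpa using hwa)
          obtain ⟨a', ha', hwa'⟩ := Finset.mem_image.1 hwZ
          have := Finset.mem_singleton.1 (hX1a ha')
          subst this
          exact absurd hwa' hbw.ne
      · obtain ⟨a, ha⟩ := hAne
        have hpos := Finset.card_pos.2 ⟨a, ha⟩
        have hce := Finset.card_erase_of_mem ha
        have := htough.three_mul_le (S := S) (A := A.erase a) (z := a)
          (Finset.card_pos.1 (by omega)) (fun x hx => hAS x (Finset.mem_of_mem_erase hx))
          (fun x hx => hN x (Finset.mem_of_mem_erase hx)) (by simp) (hAS a ha)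
        omega

theorem IsTough.two_mul_card_le_of_subset (htough : G.IsTough (3 / 2))
    (hfree : G.IsTwoKTwoFree) (hcard : 3 ≤ Fintype.card V) {X W : Finset V} (hXW : X ⊆ W) :
    2 * X.card ≤ 2 * (Fintype.card V - W.card) + ∑ x ∈ X, G.degIn W x := by
  classical
  have h1 := htough.two_mul_isolated_add_leaves_le hfree hcard hXW
  rw [Finset.card_compl, Finset.card_filter, Finset.card_filter, Finset.mul_sum,
    ← Finset.sum_add_distrib] at h1
  -- A vertex with fewer than two neighbors in `W` is short by two if isolated and by one if a leaf.
  have h2 : 2 * X.card ≤ ∑ x ∈ X, ((2 * (if G.degIn W x = 0 then 1 else 0) +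
      (if G.degIn W x = 1 then 1 else 0)) + G.degIn W x) := by
    rw [mul_comm, ← smul_eq_mul]
    refine Finset.card_nsmul_le_sum _ _ _ fun x _ => ?_
    split_ifs <;> omega
  rw [Finset.sum_add_distrib] at h2
  omega

/-- The condition for the existence of a fractional `2`-factor with weights at most one. -/
theorem IsTough.two_mul_card_add_le (htough : G.IsTough (3 / 2))
    (hfree : G.IsTwoKTwoFree) (hcard : 3 ≤ Fintype.card V) (X W : Finset V) :
    2 * X.card + 2 * W.card ≤ 2 * Fintype.card V + ∑ x ∈ X, G.degIn W x := by
  classical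
  -- Uncrossing: passing from `(X, W)` to `(X ∩ W, X ∪ W)` keeps the sum of the sizes and does not
  -- increase the number of arcs between the two sets.
  have h1 := htough.two_mul_card_le_of_subset hfree hcard (X := X ∩ W) (W := X ∪ W)
    (Finset.inter_subset_left.trans Finset.subset_union_left)
  have h2 := Finset.card_union_add_card_inter X W
  have h3 : (X ∪ W).card ≤ Fintype.card V := Finset.card_le_univ _
  have key : ∀ P Q : Finset V, ∑ x ∈ P, G.degIn Q x
      = ∑ x : V, ∑ w : V, if x ∈ P ∧ w ∈ Q ∧ G.Adj x w then 1 else 0 := by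
    intro P Q
    rw [← Finset.sum_subset (Finset.subset_univ P)]
    · refine Finset.sum_congr rfl fun x hx => ?_
      rw [degIn, Finset.card_filter, ← Finset.sum_subset (Finset.subset_univ Q)]
      · refine Finset.sum_congr rfl fun w hw => ?_
        simp [hx, hw]
      · intro w _ hw; simp [hw]
    · intro x _ hx; simp [hx]
  have h4 : ∑ x ∈ X ∩ W, G.degIn (X ∪ W) x ≤ ∑ x ∈ X, G.degIn W x := by
    rw [key, key]
    -- The inequality can fail for a single ordered pair and holds termwise only after symmetrizing.
    have hcomm : ∀ f : V → V → ℕ, 2 * ∑ x, ∑ w, f x w = ∑ x, ∑ w, (f x w + f w x) := by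
      intro f
      simp only [Finset.sum_add_distrib]
      rw [Finset.sum_comm (f := fun x w => f w x)]
      ring
    refine Nat.le_of_mul_le_mul_left (c := 2) ?_ (by norm_num)
    rw [hcomm, hcomm]
    refine Finset.sum_le_sum fun x _ => Finset.sum_le_sum fun w _ => ?_
    simp only [Finset.mem_inter, Finset.mem_union, G.adj_comm w x]
    by_cases hxX : x ∈ X <;> by_cases hxW : x ∈ W <;> by_cases hwX : w ∈ X <;>
      by_cases hwW : w ∈ W <;> by_cases hxw : G.Adj x w <;> simp [*]
  omega

theorem IsTough.two_le_deg (htough : G.IsTough (3 / 2))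
    (hfree : G.IsTwoKTwoFree) (hcard : 3 ≤ Fintype.card V) (v : V) : 2 ≤ G.degIn Finset.univ v := by
  have := htough.two_mul_card_add_le hfree hcard {v} Finset.univ
  simp only [Finset.card_singleton, Finset.card_univ, Finset.sum_singleton] at this
  omega

end Toughness

end SimpleGraph

namespace SimpleGraph

/-! ### From a fractional 2-factor to a 2-factor -/

section TwoFactor

variable {V : Type*} {G : SimpleGraph V}

open Classical in
/-- The symmetric indicator function of an edge. -/
noncomputable def edgeInd (u v a b : V) : ℤ := if s(a, b) = s(u, v) then 1 else 0

theorem edgeInd_symm (u v a b : V) : edgeInd u v a b = edgeInd u v b a := by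
  unfold edgeInd; rw [Sym2.eq_swap]

open Classical in
theorem sum_edgeInd [Fintype V] {u v : V} (h : u ≠ v) (a : V) :
    ∑ b, edgeInd u v a b = (if a = u then 1 else 0) + (if a = v then 1 else 0) := by
  have : ∀ b, edgeInd u v a b = (if b = v then (if a = u then 1 else 0) else 0)
      + (if b = u then (if a = v then 1 else 0) else 0) := by
    intro b
    unfold edgeInd
    simp only [Sym2.eq_iff]
    grind
  simp only [this, Finset.sum_add_distrib, Finset.sum_ite_eq', Finset.mem_univ, if_true]

/-- The alternating sum of the indicator functions of the edges of a walk. -/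
noncomputable def Walk.altSum : ∀ {u w : V}, G.Walk u w → V → V → ℤ
  | _, _, .nil => fun _ _ => 0
  | _, _, .cons (u := u) (v := v) _ p => fun a b => edgeInd u v a b - p.altSum a b

theorem Walk.altSum_symm {u w : V} (p : G.Walk u w) (a b : V) : p.altSum a b = p.altSum b a := by
  induction p with
  | nil => rfl
  | cons h p ih => simp only [Walk.altSum, ih, edgeInd_symm _ _ a b]

open Classical in
-- Consecutive edges carry opposite signs, so only the ends contribute. On a closed walk they cancel
-- if the length is even and add up to two if it is odd.
theorem Walk.sum_altSum [Fintype V] {u w : V} (p : G.Walk u w) (a : V) :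
    ∑ b, p.altSum a b = (if a = u then 1 else 0) - (-1) ^ p.length * (if a = w then 1 else 0) := by
  induction p with
  | nil => simp [Walk.altSum]
  | cons h p ih =>
    simp only [Walk.altSum, Finset.sum_sub_distrib, ih, sum_edgeInd h.ne, Walk.length_cons]
    ring

theorem Walk.altSum_of_notMem {u w : V} (p : G.Walk u w) {a b : V} (h : s(a, b) ∉ p.edges) :
    p.altSum a b = 0 := by
  induction p with
  | nil => rfl
  | cons h' p ih =>
    rw [Walk.edges_cons, List.mem_cons, not_or] at h
    simp [Walk.altSum, ih h.2, edgeInd, h.1]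

theorem Walk.IsTrail.altSum_of_mem {u w : V} {p : G.Walk u w} (hp : p.IsTrail) {a b : V}
    (h : s(a, b) ∈ p.edges) : p.altSum a b = 1 ∨ p.altSum a b = -1 := by
  induction p with
  | nil => simp at h
  | cons h' p ih =>
    rw [Walk.isTrail_cons] at hp
    rw [Walk.edges_cons, List.mem_cons] at h
    by_cases h1 : s(a, b) ∈ p.edges
    · have h2 : s(a, b) ≠ s(_, _) := fun h2 => hp.2 (h2 ▸ h1)
      have h3 := ih hp.1 h1
      simp only [Walk.altSum, edgeInd, h2, if_false]
      omega
    · have h2 := h.resolve_right h1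
      simp [Walk.altSum, edgeInd, h2, p.altSum_of_notMem h1]

/-- Twice a half-integral fractional `2`-factor with weights at most one. -/
structure IsHalfFactor [Fintype V] (G : SimpleGraph V) (x : V → V → ℤ) : Prop where
  symm : ∀ v w, x v w = x w v
  values : ∀ v w, x v w = 0 ∨ x v w = 1 ∨ x v w = 2
  adj : ∀ v w, x v w ≠ 0 → G.Adj v w
  sum : ∀ v, ∑ w, x v w = 4

variable [Fintype V]

open Classical in
theorem deg_eq_sum (H : SimpleGraph V) (v : V) :
    (H.deg v : ℤ) = ∑ w, if H.Adj v w then 1 else 0 := by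
  rw [deg, Set.ncard_eq_toFinset_card', Finset.sum_boole]
  congr 2
  ext w; simp

open Classical in
/-- The arcs of a `3/2`-tough `2K₂`-free graph contain a subdigraph with all in- and outdegrees
equal to two. -/
theorem IsTough.exists_two_regular_digraph (htough : G.IsTough (3 / 2))
    (hfree : G.IsTwoKTwoFree) (hcard : 3 ≤ Fintype.card V) :
    ∃ D : V → V → Prop, (∀ v w, D v w → G.Adj v w) ∧
      (∀ v, (Finset.univ.filter (fun w => D v w)).card = 2) ∧
      (∀ w, (Finset.univ.filter (fun v => D v w)).card = 2) := by
  let d : V → ℕ := G.degIn Finset.univ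
  have hd2 : ∀ v, 2 ≤ d v := htough.two_le_deg hfree hcard
  -- An arc is either selected, using one of two slots at its head, or discarded, using one of `d v
  -- - 2` slots at its tail `v`. A matching of all arcs selects at most two arcs into each vertex
  -- and at least two out of it; summation forces equality.
  let t : {a : V × V // G.Adj a.1 a.2} → Finset ((V × Fin 2) ⊕ (Σ v, Fin (d v - 2))) :=
    fun a => Finset.disjSum ({a.1.2} ×ˢ Finset.univ)
      (Finset.sigma {a.1.1} (fun _ => Finset.univ))
  have hHall : ∀ s : Finset {a : V × V // G.Adj a.1 a.2}, s.card ≤ (s.biUnion t).card := by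
    intro s
    set X := s.image (fun a => a.1.1) with hX
    set Y := s.image (fun a => a.1.2) with hY
    have hU : Finset.disjSum (Y ×ˢ Finset.univ) (X.sigma (fun _ => Finset.univ)) ⊆ s.biUnion t := by
      rintro (⟨y, i⟩ | ⟨v, j⟩) h
      · simp only [Finset.inl_mem_disjSum, Finset.mem_product, hY, Finset.mem_image] at h
        obtain ⟨⟨a, ha, rfl⟩, -⟩ := h
        exact Finset.mem_biUnion.2 ⟨a, ha, by simp [t]⟩
      · simp only [Finset.inr_mem_disjSum, Finset.mem_sigma, hX, Finset.mem_image] at h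
        obtain ⟨⟨a, ha, rfl⟩, -⟩ := h
        exact Finset.mem_biUnion.2 ⟨a, ha, by simp [t]⟩
    have hUc := Finset.card_le_card hU
    rw [Finset.card_disjSum, Finset.card_product, Finset.card_sigma] at hUc
    simp only [Finset.card_univ, Fintype.card_fin] at hUc
    have hs : s.card ≤ ∑ x ∈ X, G.degIn Y x := by
      unfold degIn
      rw [← Finset.card_sigma]
      refine Finset.card_le_card_of_injOn (fun a => ⟨a.1.1, a.1.2⟩) ?_ ?_
      · intro a ha
        have ha' : a ∈ s := ha
        simp only [Finset.coe_sigma, Set.mem_sigma_iff, Finset.mem_coe, Finset.mem_filter]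
        exact ⟨Finset.mem_image_of_mem _ ha', Finset.mem_image_of_mem _ ha', a.2⟩
      · rintro ⟨⟨a, b⟩, h⟩ _ ⟨⟨a', b'⟩, h'⟩ _ heq
        simp only [Sigma.mk.injEq, heq_eq_eq] at heq
        simp [heq.1, heq.2]
    have hsplit : ∀ x, G.degIn Y x + G.degIn Yᶜ x = d x := by
      intro x
      simp only [degIn, d]
      rw [← Finset.card_union_of_disjoint, ← Finset.filter_union, Finset.union_compl]
      exact Finset.disjoint_filter_filter disjoint_compl_right
    -- For tails `X` and heads `Y`, Hall's condition is this inequality after the arcs out of `X`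
    -- are split by whether their head lies in `Y`.
    have h1 := htough.two_mul_card_add_le hfree hcard X Yᶜ
    have h2 : Y.card + Yᶜ.card = Fintype.card V := Finset.card_add_card_compl Y
    have h3 : ∑ x ∈ X, G.degIn Y x + ∑ x ∈ X, G.degIn Yᶜ x = ∑ x ∈ X, (d x - 2) + 2 * X.card := by
      rw [← Finset.sum_add_distrib, mul_comm, ← smul_eq_mul, ← Finset.sum_const,
        ← Finset.sum_add_distrib]
      refine Finset.sum_congr rfl fun x _ => ?_
      have := hd2 x
      rw [hsplit]; omega
    omega
  obtain ⟨f, hf, hft⟩ := (Finset.all_card_le_biUnion_card_iff_exists_injective t).1 hHall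
  obtain ⟨D, hDdef⟩ : ∃ D : V → V → Prop, ∀ v w, D v w ↔
      ∃ h : G.Adj v w, ∃ i, f ⟨(v, w), h⟩ = Sum.inl (w, i) := ⟨_, fun _ _ => Iff.rfl⟩
  have hin : ∀ w, (Finset.univ.filter (fun v => D v w)).card ≤ 2 := by
    intro w
    have hi : ∀ v, ∃ i : Fin 2, D v w → ∃ h : G.Adj v w, f ⟨(v, w), h⟩ = Sum.inl (w, i) := by
      intro v
      by_cases h : D v w
      · obtain ⟨h, i, hi⟩ := (hDdef v w).1 h
        exact ⟨i, fun _ => ⟨h, hi⟩⟩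
      · exact ⟨0, fun h' => absurd h' h⟩
    choose i hi using hi
    have := Finset.card_le_card_of_injOn (s := Finset.univ.filter (fun v => D v w))
      (t := (Finset.univ : Finset (Fin 2))) i (fun _ _ => by simp) (by
        intro v hv v' hv' heq
        obtain ⟨h, hv⟩ := hi v (by simpa using hv)
        obtain ⟨h', hv'⟩ := hi v' (by simpa using hv')
        rw [heq, ← hv'] at hv
        have := hf hv
        simpa using this)
    simpa using this
  have hout : ∀ v, 2 ≤ (Finset.univ.filter (fun w => D v w)).card := by
    intro v
    have hj : ∀ w, (hw : G.Adj v w ∧ ¬ D v w) →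
        ∃ j : Fin (d v - 2), f ⟨(v, w), hw.1⟩ = Sum.inr ⟨v, j⟩ := by
      rintro w ⟨h, hD⟩
      have := hft ⟨(v, w), h⟩
      rcases hfe : f ⟨(v, w), h⟩ with ⟨y, i⟩ | ⟨y, j⟩
      · rw [hfe] at this
        simp only [t, Finset.inl_mem_disjSum, Finset.mem_product, Finset.mem_singleton] at this
        obtain ⟨rfl, -⟩ := this
        exact absurd ((hDdef _ _).2 ⟨h, i, hfe⟩) hD
      · rw [hfe] at this
        simp only [t, Finset.inr_mem_disjSum, Finset.mem_sigma, Finset.mem_singleton] at this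
        obtain ⟨rfl, -⟩ := this
        exact ⟨j, rfl⟩
    have h1 : (Finset.univ.filter (fun w => G.Adj v w ∧ ¬ D v w)).card ≤ d v - 2 := by
      have := Finset.card_le_card_of_surjOn (s := (Finset.univ : Finset (Fin (d v - 2))))
        (t := Finset.univ.filter (fun w => G.Adj v w ∧ ¬ D v w))
        (fun j => if h : ∃ w, ∃ hw : G.Adj v w, f ⟨(v, w), hw⟩ = Sum.inr ⟨v, j⟩
          then h.choose else v) (by
          intro w hw
          have hw' : G.Adj v w ∧ ¬ D v w := by simpa using hw
          obtain ⟨j, hj⟩ := hj w hw'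
          refine ⟨j, by simp, ?_⟩
          have hex : ∃ w, ∃ hw : G.Adj v w, f ⟨(v, w), hw⟩ = Sum.inr ⟨v, j⟩ := ⟨w, hw'.1, hj⟩
          simp only [hex, dif_pos]
          obtain ⟨h2, h3⟩ := hex.choose_spec
          have := hf (h3.trans hj.symm)
          simpa using this)
      simpa using this
    have h2 : (Finset.univ.filter (fun w => D v w)).card
        + (Finset.univ.filter (fun w => G.Adj v w ∧ ¬ D v w)).card = d v := by
      simp only [d, degIn]
      rw [← Finset.card_union_of_disjoint]
      · congr 1
        ext w
        simp only [Finset.mem_union, Finset.mem_filter, Finset.mem_univ, true_and]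
        constructor
        · rintro (h | h)
          exacts [((hDdef v w).1 h).1, h.1]
        · tauto
      · rw [Finset.disjoint_filter]
        exact fun w _ h h' => h'.2 h
    have := hd2 v
    omega
  have hsum : ∑ v, (Finset.univ.filter (fun w => D v w)).card
      = ∑ w, (Finset.univ.filter (fun v => D v w)).card := by
    simp only [Finset.card_filter]
    exact Finset.sum_comm
  have hle1 : ∑ v : V, 2 ≤ ∑ v, (Finset.univ.filter (fun w => D v w)).card :=
    Finset.sum_le_sum fun v _ => hout v
  have hle2 : ∑ w, (Finset.univ.filter (fun v => D v w)).card ≤ ∑ v : V, 2 :=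
    Finset.sum_le_sum fun v _ => hin v
  refine ⟨D, fun v w h => ((hDdef v w).1 h).1, fun v => ?_, fun w => ?_⟩
  · exact ((Finset.sum_eq_sum_iff_of_le (fun v _ => hout v)).1
      (le_antisymm hle1 (hsum ▸ hle2)) v (Finset.mem_univ v)).symm
  · exact (Finset.sum_eq_sum_iff_of_le (fun v _ => hin v)).1
      (le_antisymm hle2 (hsum ▸ hle1)) w (Finset.mem_univ w)

theorem IsTough.exists_isHalfFactor (htough : G.IsTough (3 / 2))
    (hfree : G.IsTwoKTwoFree) (hcard : 3 ≤ Fintype.card V) : ∃ x, G.IsHalfFactor x := by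
  classical
  obtain ⟨D, hD, hout, hin⟩ := htough.exists_two_regular_digraph hfree hcard
  refine ⟨fun v w => (if D v w then 1 else 0) + (if D w v then 1 else 0), ?_, ?_, ?_, ?_⟩
  · intro v w; ring
  · intro v w; split_ifs <;> simp
  · intro v w h
    by_cases h1 : D v w
    · exact hD v w h1
    · by_cases h2 : D w v
      · exact (hD w v h2).symm
      · simp [h1, h2] at h
  · intro v
    rw [Finset.sum_add_distrib, Finset.sum_boole, Finset.sum_boole]
    have h1 := hout v
    have h2 := hin v
    simp only [h1, h2]
    norm_num

/-- The graph of the edges of weight one half. -/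
def IsHalfFactor.halfGraph {x : V → V → ℤ} (hx : G.IsHalfFactor x) : SimpleGraph V where
  Adj v w := x v w = 1
  symm := ⟨fun v w h => by rw [hx.symm]; exact h⟩
  loopless := ⟨fun v h => G.loopless.irrefl v (hx.adj v v (by omega))⟩

/-- The graph of the edges of weight one. -/
def IsHalfFactor.fullGraph {x : V → V → ℤ} (hx : G.IsHalfFactor x) : SimpleGraph V where
  Adj v w := x v w = 2
  symm := ⟨fun v w h => by rw [hx.symm]; exact h⟩
  loopless := ⟨fun v h => G.loopless.irrefl v (hx.adj v v (by omega))⟩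

theorem IsHalfFactor.deg_add_two_mul_deg {x : V → V → ℤ} (hx : G.IsHalfFactor x) (v : V) :
    hx.halfGraph.deg v + 2 * hx.fullGraph.deg v = 4 := by
  classical
  have h : (hx.halfGraph.deg v + 2 * hx.fullGraph.deg v : ℤ) = 4 := by
    rw [deg_eq_sum, deg_eq_sum, Finset.mul_sum, ← Finset.sum_add_distrib, ← hx.sum v]
    refine Finset.sum_congr rfl fun w _ => ?_
    simp only [halfGraph, fullGraph]
    rcases hx.values v w with h | h | h <;> simp [h]
  exact_mod_cast h

theorem IsHalfFactor.even_deg {x : V → V → ℤ} (hx : G.IsHalfFactor x) (v : V) :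
    Even (hx.halfGraph.deg v) := by
  have := hx.deg_add_two_mul_deg v
  exact ⟨2 - hx.fullGraph.deg v, by omega⟩

open Classical in
-- Summing the weights over all vertices counts each half edge twice and each full edge four times,
-- for a total of `4 * |V|`.
theorem IsHalfFactor.even_card_edgeFinset {x : V → V → ℤ} (hx : G.IsHalfFactor x) :
    Even hx.halfGraph.edgeFinset.card := by
  have h1 := hx.halfGraph.sum_degrees_eq_twice_card_edges
  have h2 := hx.fullGraph.sum_degrees_eq_twice_card_edges
  simp only [← deg_eq_degree] at h1 h2
  have h3 : ∑ v, (hx.halfGraph.deg v + 2 * hx.fullGraph.deg v) = ∑ v : V, 4 :=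
    Finset.sum_congr rfl fun v _ => hx.deg_add_two_mul_deg v
  rw [Finset.sum_add_distrib, ← Finset.mul_sum, h1, h2, Finset.sum_const, smul_eq_mul] at h3
  rw [Nat.even_iff]; omega

open Classical in
/-- Alternating along an even closed trail of half edges. -/
theorem IsHalfFactor.add_altSum {x : V → V → ℤ} (hx : G.IsHalfFactor x) {u : V}
    {p : hx.halfGraph.Walk u u} (hp : p.IsTrail) (heven : Even p.length) :
    G.IsHalfFactor (fun v w => x v w + p.altSum v w) := by
  have hmem : ∀ v w, s(v, w) ∈ p.edges → x v w = 1 := fun v w h => p.adj_of_mem_edges h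
  refine ⟨fun v w => by rw [hx.symm, p.altSum_symm], fun v w => ?_, fun v w h => ?_, fun v => ?_⟩
  · by_cases h : s(v, w) ∈ p.edges
    · have := hmem v w h
      have := hp.altSum_of_mem h
      omega
    · rw [p.altSum_of_notMem h]
      have := hx.values v w
      omega
  · by_cases h' : s(v, w) ∈ p.edges
    · have := hmem v w h'
      exact hx.adj v w (by omega)
    · rw [p.altSum_of_notMem h'] at h
      exact hx.adj v w (by omega)
  · rw [Finset.sum_add_distrib, hx.sum, p.sum_altSum, heven.neg_one_pow]
    ring

open Classical in
/-- Alternating along two odd closed trails of half edges, joined by an edge. -/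
theorem IsHalfFactor.add_altSum_add_altSum {x : V → V → ℤ} (hx : G.IsHalfFactor x) {u w : V}
    {p : hx.halfGraph.Walk u u} {q : hx.halfGraph.Walk w w} (hp : p.IsTrail) (hq : q.IsTrail)
    (hpo : Odd p.length) (hqo : Odd q.length) (hdis : ∀ e ∈ p.edges, e ∉ q.edges)
    (huw : G.Adj u w) (hx1 : x u w ≠ 1) :
    G.IsHalfFactor (fun a b => x a b + (x u w - 1) *
      (p.altSum a b + q.altSum a b - 2 * edgeInd u w a b)) := by
  have hpm : ∀ v w, s(v, w) ∈ p.edges → x v w = 1 := fun v w h => p.adj_of_mem_edges h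
  have hqm : ∀ v w, s(v, w) ∈ q.edges → x v w = 1 := fun v w h => q.adj_of_mem_edges h
  have hval : x u w = 0 ∨ x u w = 2 := by have := hx.values u w; omega
  have hxe : ∀ a b, s(a, b) = s(u, w) → x a b = x u w := by
    intro a b h
    rcases Sym2.eq_iff.1 h with ⟨rfl, rfl⟩ | ⟨rfl, rfl⟩
    · rfl
    · exact hx.symm _ _
  have hcases : ∀ a b, (x a b + (x u w - 1) *
      (p.altSum a b + q.altSum a b - 2 * edgeInd u w a b) = x a b) ∨
      (x a b = 1 ∧ (x a b + (x u w - 1) *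
        (p.altSum a b + q.altSum a b - 2 * edgeInd u w a b) = 0 ∨ x a b + (x u w - 1) *
        (p.altSum a b + q.altSum a b - 2 * edgeInd u w a b) = 2)) ∨
      (G.Adj a b ∧ (x a b + (x u w - 1) *
        (p.altSum a b + q.altSum a b - 2 * edgeInd u w a b) = 0 ∨ x a b + (x u w - 1) *
        (p.altSum a b + q.altSum a b - 2 * edgeInd u w a b) = 2)) := by
    intro a b
    by_cases h1 : s(a, b) ∈ p.edges
    · right; left
      have h2 := q.altSum_of_notMem (hdis _ h1)
      have h3 := hp.altSum_of_mem h1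
      have h4 : s(a, b) ≠ s(u, w) := fun h => hx1 (by rw [← hxe a b h]; exact hpm a b h1)
      refine ⟨hpm a b h1, ?_⟩
      simp only [hpm a b h1, h2, edgeInd, h4, if_false]
      rcases hval with h | h <;> rcases h3 with h3 | h3 <;> simp [h, h3]
    · by_cases h2 : s(a, b) ∈ q.edges
      · right; left
        have h2' := p.altSum_of_notMem h1
        have h3 := hq.altSum_of_mem h2
        have h4 : s(a, b) ≠ s(u, w) := fun h => hx1 (by rw [← hxe a b h]; exact hqm a b h2)
        refine ⟨hqm a b h2, ?_⟩
        simp only [hqm a b h2, h2', edgeInd, h4, if_false]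
        rcases hval with h | h <;> rcases h3 with h3 | h3 <;> simp [h, h3]
      · rw [p.altSum_of_notMem h1, q.altSum_of_notMem h2]
        by_cases h3 : s(a, b) = s(u, w)
        · right; right
          refine ⟨?_, ?_⟩
          · rcases Sym2.eq_iff.1 h3 with ⟨rfl, rfl⟩ | ⟨rfl, rfl⟩
            exacts [huw, huw.symm]
          · simp only [hxe a b h3, edgeInd, h3, if_true]
            rcases hval with h | h <;> simp [h]
        · left
          simp [edgeInd, h3]
  refine ⟨fun a b => ?_, fun a b => ?_, fun a b h => ?_, fun a => ?_⟩
  · rw [hx.symm a b, p.altSum_symm a b, q.altSum_symm a b, edgeInd_symm u w a b]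
  · have := hx.values a b
    rcases hcases a b with h | h | h <;> omega
  · rcases hcases a b with h' | h' | h'
    · exact hx.adj a b (by rwa [h'] at h)
    · exact hx.adj a b (by omega)
    · exact h'.1
  -- Each odd tour contributes two at its base point, and twice the edge `uw` cancels both. The
  -- factor `x u w - 1 = ±1` sends the weight of `uw` from 0 to 2 or back.
  · rw [Finset.sum_add_distrib, hx.sum, ← Finset.mul_sum, Finset.sum_sub_distrib,
      Finset.sum_add_distrib, ← Finset.mul_sum, p.sum_altSum, q.sum_altSum, sum_edgeInd huw.ne,
      hpo.neg_one_pow, hqo.neg_one_pow]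
    ring

open Classical in
/-- A half-integral fractional `2`-factor with a half edge can be improved. -/
theorem IsHalfFactor.exists_improvement (hfree : G.IsTwoKTwoFree) {x : V → V → ℤ}
    (hx : G.IsHalfFactor x) {a b : V} (hab : x a b = 1) :
    ∃ y, G.IsHalfFactor y ∧ (∀ v w, y v w = 1 → x v w = 1) ∧ ∃ v w, x v w = 1 ∧ y v w ≠ 1 := by
  set K := hx.halfGraph with hK
  have heven : ∀ v, Even (K.deg v) := hx.even_deg
  have heven_case : ∀ u u', K.Adj u u' → ∀ p : K.Walk u u, p.IsTrail → s(u, u') ∈ p.edges →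
      Even p.length →
      ∃ y, G.IsHalfFactor y ∧ (∀ v w, y v w = 1 → x v w = 1) ∧ ∃ v w, x v w = 1 ∧ y v w ≠ 1 := by
    intro u u' hu p hp hmem hev
    refine ⟨_, hx.add_altSum hp hev, fun v w h => ?_, u, u', hu, ?_⟩
    · by_cases h' : s(v, w) ∈ p.edges
      · exact p.adj_of_mem_edges h'
      · rwa [p.altSum_of_notMem h', add_zero] at h
    · have h1 : x u u' = 1 := hu
      have := hp.altSum_of_mem hmem
      omega
  obtain ⟨p, hp, hpc⟩ := exists_closed_trail_covering heven a
  by_cases hpe : Even p.length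
  · exact heven_case a b hab p hp (hpc a b (Reachable.refl a) hab) hpe
  -- The number of half edges is even, so an odd tour misses one of them, and that one lies in
  -- another component.
  obtain ⟨c, d, hcd, hcdp⟩ : ∃ c d, K.Adj c d ∧ s(c, d) ∉ p.edges := by
    by_contra! hcon
    have h1 : K.edgeFinset = p.edges.toFinset := by
      ext e
      induction e with
      | _ v w =>
        rw [mem_edgeFinset, List.mem_toFinset, mem_edgeSet]
        exact ⟨fun h => hcon v w h, fun h => p.adj_of_mem_edges h⟩
    have h2 := hx.even_card_edgeFinset
    rw [← hK, h1, List.toFinset_card_of_nodup hp.edges_nodup, Walk.length_edges] at h2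
    exact hpe h2
  have hac : ¬ K.Reachable a c := fun h => hcdp (hpc c d h hcd)
  have hK1 : ∀ {v w}, K.Adj v w → G.Adj v w := by
    intro v w h
    have h' : x v w = 1 := h
    exact hx.adj v w (by omega)
  have hab' : K.Adj a b := hab
  obtain ⟨u, u', w, w', huu, hww, huw, hau, hcw⟩ : ∃ u u' w w', K.Adj u u' ∧ K.Adj w w' ∧
      G.Adj u w ∧ K.Reachable a u ∧ K.Reachable c w := by
    have h := hfree.exists_adj (hK1 hab') (hK1 hcd)
      (by rintro rfl; exact hac (Reachable.refl _))
      (by rintro rfl; exact hac hcd.symm.reachable)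
      (by rintro rfl; exact hac hab'.reachable)
      (by rintro rfl; exact hac (hab'.reachable.trans hcd.symm.reachable))
    rcases h with h | h | h | h
    · exact ⟨a, b, c, d, hab', hcd, h, Reachable.refl _, Reachable.refl _⟩
    · exact ⟨a, b, d, c, hab', hcd.symm, h, Reachable.refl _, hcd.reachable⟩
    · exact ⟨b, a, c, d, hab'.symm, hcd, h, hab'.reachable, Reachable.refl _⟩
    · exact ⟨b, a, d, c, hab'.symm, hcd.symm, h, hab'.reachable, hcd.reachable⟩
  have hnr : ¬ K.Reachable u w := fun h => hac ((hau.trans h).trans hcw.symm)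
  -- The tours are based anew at the ends of the joining edge, where the surplus of an odd tour has
  -- to sit.
  obtain ⟨p, hp, hpc⟩ := exists_closed_trail_covering heven u
  obtain ⟨q, hq, hqc⟩ := exists_closed_trail_covering heven w
  have hpu := hpc u u' (Reachable.refl u) huu
  by_cases hpe : Even p.length
  · exact heven_case u u' huu p hp hpu hpe
  by_cases hqe : Even q.length
  · exact heven_case w w' hww q hq (hqc w w' (Reachable.refl w) hww) hqe
  have hdis : ∀ e ∈ p.edges, e ∉ q.edges := by
    intro e h1 h2
    induction e with
    | _ v z =>
      exact hnr ((p.takeUntil v (p.fst_mem_support_of_mem_edges h1)).reachable.trans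
        (q.takeUntil v (q.fst_mem_support_of_mem_edges h2)).reachable.symm)
  have hx1 : x u w ≠ 1 := fun h => hnr (Adj.reachable (show K.Adj u w from h))
  refine ⟨_, hx.add_altSum_add_altSum hp hq (Nat.not_even_iff_odd.1 hpe)
    (Nat.not_even_iff_odd.1 hqe) hdis huw hx1, fun v z h => ?_, u, u', huu, ?_⟩
  · by_cases h1 : s(v, z) ∈ p.edges
    · exact p.adj_of_mem_edges h1
    by_cases h2 : s(v, z) ∈ q.edges
    · exact q.adj_of_mem_edges h2
    rw [p.altSum_of_notMem h1, q.altSum_of_notMem h2] at h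
    have hval := hx.values v z
    have hval' := hx.values u w
    unfold edgeInd at h
    split_ifs at h
    · rcases hval' with h' | h' | h'
      · rw [h'] at h; omega
      · exact absurd h' hx1
      · rw [h'] at h; omega
    · simpa using h
  · have h0 : x u u' = 1 := huu
    have h1 := hp.altSum_of_mem hpu
    have h2 := q.altSum_of_notMem (hdis _ hpu)
    have h3 : s(u, u') ≠ s(u, w) := by
      intro h
      have := Sym2.congr_right.1 h
      exact hx1 (this ▸ h0)
    have hval' := hx.values u w
    simp only [h0, h2, edgeInd, h3, if_false]
    rcases hval' with h' | h' | h' <;> rcases h1 with h1 | h1 <;> simp [h', h1]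
    all_goals exact absurd h' hx1

open Classical in
theorem IsHalfFactor.exists_two_factor (hfree : G.IsTwoKTwoFree) (n : ℕ) :
    ∀ x : V → V → ℤ, G.IsHalfFactor x →
      (Finset.univ.filter (fun a : V × V => x a.1 a.2 = 1)).card = n →
      ∃ H ≤ G, ∀ v, H.deg v = 2 := by
  induction n using Nat.strong_induction_on with
  | _ n ih =>
    intro x hx hn
    by_cases h : ∃ a b, x a b = 1
    · obtain ⟨a, b, hab⟩ := h
      obtain ⟨y, hy, hyx, v, w, hxv, hyv⟩ := hx.exists_improvement hfree hab
      refine ih _ ?_ y hy rfl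
      rw [← hn]
      refine Finset.card_lt_card ⟨fun c hc => ?_, fun hcon => ?_⟩
      · simp only [Finset.mem_filter, Finset.mem_univ, true_and] at hc ⊢
        exact hyx _ _ hc
      · have := hcon (show (v, w) ∈ _ by simpa using hxv)
        simp only [Finset.mem_filter, Finset.mem_univ, true_and] at this
        exact hyv this
    · push Not at h
      refine ⟨hx.fullGraph, fun v w hvw => ?_, fun v => ?_⟩
      · have : x v w = 2 := hvw
        exact hx.adj v w (by omega)
      · have h1 := hx.deg_add_two_mul_deg v
        have h2 : ¬ 0 < hx.halfGraph.deg v := by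
          rw [deg_pos_iff]
          rintro ⟨w, hw⟩
          exact h v w hw
        omega

/-- A `3/2`-tough `2K₂`-free graph with at least three vertices has a `2`-factor. -/
theorem IsTough.exists_two_factor (htough : G.IsTough (3 / 2))
    (hfree : G.IsTwoKTwoFree) (hcard : 3 ≤ Fintype.card V) : ∃ H ≤ G, ∀ v, H.deg v = 2 := by
  obtain ⟨x, hx⟩ := htough.exists_isHalfFactor hfree hcard
  exact IsHalfFactor.exists_two_factor hfree _ x hx rfl

end TwoFactor

end SimpleGraph

namespace SimpleGraph

/-! ### Local exchanges that merge two components -/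

section Merging

variable {V : Type*} {G H H' L : SimpleGraph V} {a b : V}

theorem Reachable.lift_on {x y : V} (h : L.Reachable x y)
    (hf : ∀ u v, L.Reachable x u → L.Adj u v → H'.Reachable u v) : H'.Reachable x y := by
  obtain ⟨p⟩ := h
  induction p with
  | nil => exact Reachable.refl _
  | cons hadj p ih =>
    exact (hf _ _ (Reachable.refl _) hadj).trans
      (ih fun u v hu huv => hf u v (hadj.reachable.trans hu) huv)

/-- Two predicates that both alternate along the edges of a component agree everywhere on it or
nowhere. -/
theorem Reachable.iff_iff_of_alternating {A B : V → Prop} {y z : V} (hyz : H.Reachable y z)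
    (hA : ∀ u v, H.Reachable y u → H.Adj u v → (A u ↔ ¬ A v))
    (hB : ∀ u v, H.Reachable y u → H.Adj u v → (B u ↔ ¬ B v)) :
    (A y ↔ B y) ↔ (A z ↔ B z) := by
  obtain ⟨p⟩ := hyz
  induction p with
  | nil => exact Iff.rfl
  | cons hadj p ih =>
    rw [← ih (fun u v hu => hA u v (hadj.reachable.trans hu))
      (fun u v hu => hB u v (hadj.reachable.trans hu))]
    have h1 := hA _ _ (Reachable.refl _) hadj
    have h2 := hB _ _ (Reachable.refl _) hadj
    tauto

/-- `H` is a spanning subgraph of the `2K₂`-free graph `G` with all degrees two or four, the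
vertices `a` and `b` lie in different components of `H`, and these two components cannot be merged
by a change of `H` within their union. -/
structure Unmergeable (G H : SimpleGraph V) (a b : V) : Prop where
  free : G.IsTwoKTwoFree
  le : H ≤ G
  deg : ∀ v, H.deg v = 2 ∨ H.deg v = 4
  not_reachable : ¬ H.Reachable a b
  not_merged : ∀ H' ≤ G, (∀ v, H'.deg v = 2 ∨ H'.deg v = 4) →
    -- This clause keeps the degrees outside the large component equal to two in the extremal
    -- argument.
    (∀ v, ¬ H.Reachable a v → ¬ H.Reachable b v → H'.deg v = H.deg v) →
    (∀ u v, H.Adj u v → H'.Reachable u v) → ¬ H'.Reachable a b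

namespace Unmergeable

theorem symm (c : Unmergeable G H a b) : Unmergeable G H b a where
  free := c.free
  le := c.le
  deg := c.deg
  not_reachable h := c.not_reachable h.symm
  not_merged H' hle hdeg hoff hlift h :=
    c.not_merged H' hle hdeg (fun v h1 h2 => hoff v h2 h1) hlift h.symm

theorem elim (c : Unmergeable G H a b) (hle : H' ≤ G) (hdeg : ∀ v, H'.deg v = 2 ∨ H'.deg v = 4)
    (hoff : ∀ v, ¬ H.Reachable a v → ¬ H.Reachable b v → H'.deg v = H.deg v)
    (hlift : ∀ u v, H.Adj u v → H'.Reachable u v) {x y : V} (hx : H.Reachable b x)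
    (hy : H.Reachable a y) (hxy : H'.Reachable x y) : False :=
  c.not_merged H' hle hdeg hoff hlift
    ((hy.lift_on fun u v _ => hlift u v).trans
      (hxy.symm.trans (hx.lift_on fun u v _ => hlift u v).symm))

theorem not_adj (c : Unmergeable G H a b) {x y : V} (hx : H.Reachable b x) (hy : H.Reachable a y) :
    ¬ H.Adj x y := fun h => c.not_reachable (hy.trans (h.symm.reachable.trans hx.symm))

theorem ne (c : Unmergeable G H a b) {x y : V} (hx : H.Reachable b x) (hy : H.Reachable a y) :
    x ≠ y := by
  rintro rfl
  exact c.not_reachable (hy.trans hx.symm)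

theorem even_deg (c : Unmergeable G H a b) (v : V) : Even (H.deg v) := by
  rcases c.deg v with h | h <;> rw [h] <;> decide

variable [Finite V]

/-- Otherwise the edge `y₁y₂` could be rerouted through `x`, whose degree rises from two to four. -/
theorem no_triangle (c : Unmergeable G H a b) {x y₁ y₂ : V} (hx : H.Reachable b x)
    (hx2 : H.deg x = 2) (hy : H.Reachable a y₁) (hyy : H.Adj y₁ y₂) (h1 : G.Adj x y₁)
    (h2 : G.Adj x y₂) : False := by
  classical
  have hy2 : H.Reachable a y₂ := hy.trans hyy.reachable
  have n1 := c.not_adj hx hy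
  have n2 := c.not_adj hx hy2
  have e1 := hyy.ne
  have hd : ∀ v, (((H \ edge y₁ y₂) ⊔ edge x y₁) ⊔ edge x y₂).deg v
      = H.deg v + 2 * (if v = x then 1 else 0) := by
    intro v
    have d1 := deg_sdiff_edge hyy v
    have d2 := deg_sup_edge (H := H \ edge y₁ y₂) h1.ne (by simp [n1]) v
    have d3 := deg_sup_edge (H := (H \ edge y₁ y₂) ⊔ edge x y₁) h2.ne
      (by have := h1.ne; have := h2.ne; simp [n2, edge_adj]; grind) v
    omega
  refine c.elim (H' := ((H \ edge y₁ y₂) ⊔ edge x y₁) ⊔ edge x y₂)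
    (sup_le (sup_le (sdiff_le.trans c.le) ((edge_le_iff _).2 (Or.inr h1)))
      ((edge_le_iff _).2 (Or.inr h2))) ?_ ?_ ?_ hx hy ?_
  · intro v
    rw [hd]
    have := c.deg v
    split_ifs with h
    · subst h; omega
    · omega
  · intro v _ hv
    rw [hd, if_neg (by rintro rfl; exact hv hx)]
    omega
  · have r1 : (((H \ edge y₁ y₂) ⊔ edge x y₁) ⊔ edge x y₂).Adj x y₁ := by
      simp [edge_adj, h1.ne]
    have r2 : (((H \ edge y₁ y₂) ⊔ edge x y₁) ⊔ edge x y₂).Adj x y₂ := by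
      simp [edge_adj, h2.ne]
    intro u v huv
    by_cases he : (edge y₁ y₂).Adj u v
    · rw [edge_adj] at he
      rcases he.1 with ⟨rfl, rfl⟩ | ⟨rfl, rfl⟩
      · exact r1.symm.reachable.trans r2.reachable
      · exact r2.symm.reachable.trans r1.reachable
    · exact Adj.reachable (Or.inl (Or.inl ⟨huv, he⟩))
  · exact Adj.reachable (by simp [edge_adj, h1.ne])

/-- Otherwise `x₁x₂`, `y₁y₂` could be exchanged for `x₁y₁`, `x₂y₂` with all degrees kept. Since
`x₁x₂` is not a bridge, its ends stay joined, and the rest is reattached through them. -/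
theorem no_parallel (c : Unmergeable G H a b) {x₁ x₂ y₁ y₂ : V} (hx : H.Reachable b x₁)
    (hxx : H.Adj x₁ x₂) (hy : H.Reachable a y₁) (hyy : H.Adj y₁ y₂) (h1 : G.Adj x₁ y₁)
    (h2 : G.Adj x₂ y₂) : False := by
  classical
  have hy2 : H.Reachable a y₂ := hy.trans hyy.reachable
  have hx2 : H.Reachable b x₂ := hx.trans hxx.reachable
  have n1 := c.not_adj hx hy
  have n2 := c.not_adj hx2 hy2
  have e1 := hyy.ne
  have e2 := hxx.ne
  have f1 := c.ne hx hy
  have f2 := c.ne hx hy2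
  have f3 := c.ne hx2 hy
  have f4 := c.ne hx2 hy2
  set J := (H \ edge x₁ x₂) \ edge y₁ y₂ with hJ
  have hyy' : (H \ edge x₁ x₂).Adj y₁ y₂ := ⟨hyy, by simp [edge_adj]; grind⟩
  have hd : ∀ v, ((J ⊔ edge x₁ y₁) ⊔ edge x₂ y₂).deg v = H.deg v := by
    intro v
    have d1 := deg_sdiff_edge hxx v
    have d2 := deg_sdiff_edge hyy' v
    rw [← hJ] at d2
    have d3 := deg_sup_edge (H := J) f1 (by simp [hJ, n1]) v
    have d4 := deg_sup_edge (H := J ⊔ edge x₁ y₁) f4 (by simp [hJ, n2, edge_adj]; grind) v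
    omega
  have r1 : ((J ⊔ edge x₁ y₁) ⊔ edge x₂ y₂).Adj x₁ y₁ := by simp [edge_adj, f1]
  have r2 : ((J ⊔ edge x₁ y₁) ⊔ edge x₂ y₂).Adj x₂ y₂ := by simp [edge_adj, f4]
  have r3 : ((J ⊔ edge x₁ y₁) ⊔ edge x₂ y₂).Reachable x₁ x₂ := by
    refine (reachable_sdiff_edge_of_even c.even_deg hxx).lift_on fun u v hu huv => ?_
    have hu' : H.Reachable b u := hx.trans (hu.mono sdiff_le)
    refine Adj.reachable (Or.inl (Or.inl ⟨huv, ?_⟩))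
    have g1 := c.ne hu' hy
    have g2 := c.ne hu' hy2
    rw [edge_adj]
    grind
  have r4 := (r1.symm.reachable.trans r3).trans r2.reachable
  refine c.elim (H' := (J ⊔ edge x₁ y₁) ⊔ edge x₂ y₂)
    (sup_le (sup_le ((sdiff_le.trans sdiff_le).trans c.le) ((edge_le_iff _).2 (Or.inr h1)))
      ((edge_le_iff _).2 (Or.inr h2))) (fun v => hd v ▸ c.deg v) (fun v _ _ => hd v) ?_ hx hy
      r1.reachable
  intro u v huv
  by_cases he : (edge x₁ x₂).Adj u v
  · rw [edge_adj] at he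
    rcases he.1 with ⟨rfl, rfl⟩ | ⟨rfl, rfl⟩
    exacts [r3, r3.symm]
  · by_cases he' : (edge y₁ y₂).Adj u v
    · rw [edge_adj] at he'
      rcases he'.1 with ⟨rfl, rfl⟩ | ⟨rfl, rfl⟩
      exacts [r4, r4.symm]
    · exact Adj.reachable (Or.inl (Or.inl ⟨⟨huv, he⟩, he'⟩))

end Unmergeable

variable [Finite V]

/-- At a vertex of degree four, two edges can be removed without a loss of connectedness. -/
theorem exists_split_of_deg_eq_four (heven : ∀ v, Even (H.deg v)) {q : V} (hq : H.deg q = 4) :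
    ∃ p₁ p₂, p₁ ≠ p₂ ∧ H.Adj q p₁ ∧ H.Adj q p₂ ∧
      ((H \ edge q p₁) \ edge q p₂).Reachable q p₁ := by
  classical
  obtain ⟨p₁, hp₁⟩ := deg_pos_iff.1 (show 0 < H.deg q by omega)
  obtain ⟨r, hr⟩ := (reachable_sdiff_edge_of_even heven hp₁).exists_isPath
  cases r with
  | nil => exact absurd rfl hp₁.ne
  | @cons _ z _ hz r =>
    rw [Walk.cons_isPath_iff] at hr
    -- The path from `q` to `p₁` avoiding their edge leaves `q` through `z` and never returns, so it
    -- also avoids `qp₂` for any third neighbor `p₂`.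
    have h1 : ((H.neighborSet q) \ {p₁, z}).Nonempty := by
      rw [← Set.ncard_pos (Set.toFinite _)]
      have h2 := Set.le_ncard_sdiff {p₁, z} (H.neighborSet q)
      have h3 : ({p₁, z} : Set V).ncard ≤ 2 := (Set.ncard_insert_le _ _).trans (by simp)
      unfold deg at hq
      omega
    obtain ⟨p₂, hp₂, hne⟩ := h1
    simp only [Set.mem_insert_iff, Set.mem_singleton_iff, not_or] at hne
    refine ⟨p₁, p₂, Ne.symm hne.1, hp₁, hp₂, ?_⟩
    have hqz := hz.ne
    have h2 : ((H \ edge q p₁) \ edge q p₂).Adj q z := ⟨hz, by rw [edge_adj]; grind⟩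
    refine h2.reachable.trans ?_
    have : ∀ {x y : V} (s : (H \ edge q p₁).Walk x y), q ∉ s.support →
        ((H \ edge q p₁) \ edge q p₂).Reachable x y := by
      intro x y s
      induction s with
      | nil => exact fun _ => Reachable.refl _
      | @cons x w y hxw s ih =>
        intro hs
        rw [Walk.support_cons, List.mem_cons, not_or] at hs
        have hw : q ≠ w := by
          rintro rfl
          exact hs.2 s.start_mem_support
        have h3 : ((H \ edge q p₁) \ edge q p₂).Adj x w := ⟨hxw, by rw [edge_adj]; grind⟩
        exact h3.reachable.trans (ih hs.2)
    exact this r hr.2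

namespace Unmergeable

/-- Otherwise the path `p₁qp₂` could be replaced by `p₁xp₂`: `q` drops to degree two, `x` rises to
four, and `hr` keeps `q` attached. -/
theorem no_split_same (c : Unmergeable G H a b) {x q p₁ p₂ : V} (hx : H.Reachable b x)
    (hx2 : H.deg x = 2) (hq : H.Reachable a q) (hq4 : H.deg q = 4) (hp : p₁ ≠ p₂)
    (hp₁ : H.Adj q p₁) (hp₂ : H.Adj q p₂)
    (hr : ((H \ edge q p₁) \ edge q p₂).Reachable q p₁) (h1 : G.Adj x p₁) (h2 : G.Adj x p₂) :
    False := by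
  classical
  have hy1 : H.Reachable a p₁ := hq.trans hp₁.reachable
  have hy2 : H.Reachable a p₂ := hq.trans hp₂.reachable
  have n1 := c.not_adj hx hy1
  have n2 := c.not_adj hx hy2
  have e1 := hp₁.ne
  have e2 := hp₂.ne
  have f0 := c.ne hx hq
  have f1 := c.ne hx hy1
  have f2 := c.ne hx hy2
  set J := (H \ edge q p₁) \ edge q p₂ with hJ
  have hp₂' : (H \ edge q p₁).Adj q p₂ := ⟨hp₂, by rw [edge_adj]; grind⟩
  have hd : ∀ v, ((J ⊔ edge x p₁) ⊔ edge x p₂).deg v + 2 * (if v = q then 1 else 0)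
      = H.deg v + 2 * (if v = x then 1 else 0) := by
    intro v
    have d1 := deg_sdiff_edge hp₁ v
    have d2 := deg_sdiff_edge hp₂' v
    rw [← hJ] at d2
    have d3 := deg_sup_edge (H := J) f1 (by simp [hJ, n1]) v
    have d4 := deg_sup_edge (H := J ⊔ edge x p₁) f2 (by simp [hJ, n2, edge_adj]; grind) v
    omega
  have r1 : ((J ⊔ edge x p₁) ⊔ edge x p₂).Adj x p₁ := by simp [edge_adj, f1]
  have r2 : ((J ⊔ edge x p₁) ⊔ edge x p₂).Adj x p₂ := by simp [edge_adj, f2]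
  have r3 : ((J ⊔ edge x p₁) ⊔ edge x p₂).Reachable q p₁ :=
    hr.mono (le_sup_left.trans le_sup_left)
  have r4 := (r3.trans r1.symm.reachable).trans r2.reachable
  refine c.elim (H' := (J ⊔ edge x p₁) ⊔ edge x p₂)
    (sup_le (sup_le ((sdiff_le.trans sdiff_le).trans c.le) ((edge_le_iff _).2 (Or.inr h1)))
      ((edge_le_iff _).2 (Or.inr h2))) ?_ ?_ ?_ hx hy1 r1.reachable
  · intro v
    have hv := hd v
    have := c.deg v
    by_cases hvx : v = x
    · subst hvx; simp only [f0, if_true, if_false] at hv; omega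
    · by_cases hvq : v = q
      · subst hvq; simp only [hvx, if_true, if_false] at hv; omega
      · simp only [hvx, hvq, if_false] at hv; omega
  · intro v hva hvb
    have hv := hd v
    rw [if_neg (by rintro rfl; exact hva hq), if_neg (by rintro rfl; exact hvb hx)] at hv
    omega
  · intro u v huv
    by_cases he : (edge q p₁).Adj u v
    · rw [edge_adj] at he
      rcases he.1 with ⟨rfl, rfl⟩ | ⟨rfl, rfl⟩
      exacts [r3, r3.symm]
    · by_cases he' : (edge q p₂).Adj u v
      · rw [edge_adj] at he'
        rcases he'.1 with ⟨rfl, rfl⟩ | ⟨rfl, rfl⟩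
        exacts [r4, r4.symm]
      · exact Adj.reachable (Or.inl (Or.inl ⟨⟨huv, he⟩, he'⟩))

/-- The detour from `p₁` to `p₂` now runs through the component of `b`, between the ends of the
deleted non-bridge `x₁x₂`. -/
theorem no_split_cross (c : Unmergeable G H a b) {x₁ x₂ q p₁ p₂ : V} (hx : H.Reachable b x₁)
    (hxx : H.Adj x₁ x₂) (hq : H.Reachable a q) (hq4 : H.deg q = 4) (hp : p₁ ≠ p₂)
    (hp₁ : H.Adj q p₁) (hp₂ : H.Adj q p₂)
    (hr : ((H \ edge q p₁) \ edge q p₂).Reachable q p₁) (h1 : G.Adj x₁ p₁) (h2 : G.Adj x₂ p₂) :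
    False := by
  classical
  have hx2 : H.Reachable b x₂ := hx.trans hxx.reachable
  have hy1 : H.Reachable a p₁ := hq.trans hp₁.reachable
  have hy2 : H.Reachable a p₂ := hq.trans hp₂.reachable
  have n1 := c.not_adj hx hy1
  have n2 := c.not_adj hx2 hy2
  have e1 := hp₁.ne
  have e2 := hp₂.ne
  have e3 := hxx.ne
  have f0 := c.ne hx hq
  have f1 := c.ne hx hy1
  have f2 := c.ne hx2 hy2
  have f3 := c.ne hx2 hq
  have f4 := c.ne hx hy2
  have f5 := c.ne hx2 hy1
  set J := ((H \ edge q p₁) \ edge q p₂) \ edge x₁ x₂ with hJ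
  have hp₂' : (H \ edge q p₁).Adj q p₂ := ⟨hp₂, by rw [edge_adj]; grind⟩
  have hxx' : ((H \ edge q p₁) \ edge q p₂).Adj x₁ x₂ :=
    ⟨⟨hxx, by rw [edge_adj]; grind⟩, by rw [edge_adj]; grind⟩
  have hd : ∀ v, ((J ⊔ edge x₁ p₁) ⊔ edge x₂ p₂).deg v + 2 * (if v = q then 1 else 0)
      = H.deg v := by
    intro v
    have d1 := deg_sdiff_edge hp₁ v
    have d2 := deg_sdiff_edge hp₂' v
    have d5 := deg_sdiff_edge hxx' v
    rw [← hJ] at d5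
    have d3 := deg_sup_edge (H := J) f1 (by simp [hJ, n1]) v
    have d4 := deg_sup_edge (H := J ⊔ edge x₁ p₁) f2 (by simp [hJ, n2, edge_adj]; grind) v
    omega
  have r1 : ((J ⊔ edge x₁ p₁) ⊔ edge x₂ p₂).Adj x₁ p₁ := by simp [edge_adj, f1]
  have r2 : ((J ⊔ edge x₁ p₁) ⊔ edge x₂ p₂).Adj x₂ p₂ := by simp [edge_adj, f2]
  have r0 : ((J ⊔ edge x₁ p₁) ⊔ edge x₂ p₂).Reachable x₁ x₂ := by
    refine (reachable_sdiff_edge_of_even c.even_deg hxx).lift_on fun u v hu huv => ?_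
    have hu' : H.Reachable b u := hx.trans (hu.mono sdiff_le)
    have g1 := c.ne hu' hq
    have g2 := c.ne hu' hy1
    have g3 := c.ne hu' hy2
    refine Adj.reachable (Or.inl (Or.inl ⟨⟨⟨huv.1, ?_⟩, ?_⟩, huv.2⟩)) <;> rw [edge_adj] <;> grind
  have r3 : ((J ⊔ edge x₁ p₁) ⊔ edge x₂ p₂).Reachable q p₁ := by
    refine hr.lift_on fun u v hu huv => ?_
    have hu' : H.Reachable a u := hq.trans (hu.mono (sdiff_le.trans sdiff_le))
    have g1 := c.ne hx hu'
    have g2 := c.ne hx2 hu'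
    refine Adj.reachable (Or.inl (Or.inl ⟨huv, ?_⟩))
    rw [edge_adj]; grind
  have r4 := ((r3.trans r1.symm.reachable).trans r0).trans r2.reachable
  refine c.elim (H' := (J ⊔ edge x₁ p₁) ⊔ edge x₂ p₂)
    (sup_le (sup_le (((sdiff_le.trans sdiff_le).trans sdiff_le).trans c.le)
      ((edge_le_iff _).2 (Or.inr h1)))
      ((edge_le_iff _).2 (Or.inr h2))) ?_ ?_ ?_ hx hy1 r1.reachable
  · intro v
    have hv := hd v
    have := c.deg v
    by_cases hvq : v = q
    · subst hvq; simp only [if_true] at hv; omega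
    · simp only [hvq, if_false] at hv; omega
  · intro v hva hvb
    have hv := hd v
    rw [if_neg (by rintro rfl; exact hva hq)] at hv
    omega
  · intro u v huv
    by_cases he : (edge q p₁).Adj u v
    · rw [edge_adj] at he
      rcases he.1 with ⟨rfl, rfl⟩ | ⟨rfl, rfl⟩
      exacts [r3, r3.symm]
    · by_cases he' : (edge q p₂).Adj u v
      · rw [edge_adj] at he'
        rcases he'.1 with ⟨rfl, rfl⟩ | ⟨rfl, rfl⟩
        exacts [r4, r4.symm]
      · by_cases he'' : (edge x₁ x₂).Adj u v
        · rw [edge_adj] at he''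
          rcases he''.1 with ⟨rfl, rfl⟩ | ⟨rfl, rfl⟩
          exacts [r0, r0.symm]
        · exact Adj.reachable (Or.inl (Or.inl ⟨⟨⟨huv, he⟩, he'⟩, he''⟩))

/-- Adding the whole 4-cycle would raise its four vertices from degree two to four. -/
theorem no_square (c : Unmergeable G H a b) {x₁ x₂ y₁ y₂ : V} (hx1 : H.Reachable b x₁)
    (hx2 : H.Reachable b x₂) (hy1 : H.Reachable a y₁) (hy2 : H.Reachable a y₂) (hx : x₁ ≠ x₂)
    (hy : y₁ ≠ y₂) (dx1 : H.deg x₁ = 2) (dx2 : H.deg x₂ = 2) (dy1 : H.deg y₁ = 2)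
    (dy2 : H.deg y₂ = 2) (h11 : G.Adj x₁ y₁) (h12 : G.Adj x₁ y₂) (h21 : G.Adj x₂ y₁)
    (h22 : G.Adj x₂ y₂) : False := by
  classical
  have n1 := c.not_adj hx1 hy1
  have n2 := c.not_adj hx1 hy2
  have n3 := c.not_adj hx2 hy1
  have n4 := c.not_adj hx2 hy2
  have f1 := c.ne hx1 hy1
  have f2 := c.ne hx1 hy2
  have f3 := c.ne hx2 hy1
  have f4 := c.ne hx2 hy2
  set K := ((H ⊔ edge x₁ y₁) ⊔ edge x₁ y₂) ⊔ edge x₂ y₁ with hK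
  have hd : ∀ v, (K ⊔ edge x₂ y₂).deg v = H.deg v + 2 * (if v = x₁ then 1 else 0)
      + 2 * (if v = x₂ then 1 else 0) + 2 * (if v = y₁ then 1 else 0)
      + 2 * (if v = y₂ then 1 else 0) := by
    intro v
    have d1 := deg_sup_edge (H := H) f1 n1 v
    have d2 := deg_sup_edge (H := H ⊔ edge x₁ y₁) f2 (by simp [n2, edge_adj]; grind) v
    have d3 := deg_sup_edge (H := (H ⊔ edge x₁ y₁) ⊔ edge x₁ y₂) f3
      (by simp [n3, edge_adj]; grind) v
    rw [← hK] at d3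
    have d4 := deg_sup_edge (H := K) f4 (by simp [hK, n4, edge_adj]; grind) v
    omega
  have hle : H ≤ K := (le_sup_left.trans le_sup_left).trans le_sup_left
  refine c.elim (H' := K ⊔ edge x₂ y₂)
    (sup_le (sup_le (sup_le (sup_le c.le ((edge_le_iff _).2 (Or.inr h11)))
      ((edge_le_iff _).2 (Or.inr h12))) ((edge_le_iff _).2 (Or.inr h21)))
      ((edge_le_iff _).2 (Or.inr h22))) ?_ ?_
      (fun u v huv => Adj.reachable (Or.inl (hle huv))) hx2 hy2
      (Adj.reachable (by simp [edge_adj, f4]))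
  · intro v
    rw [hd]
    have := c.deg v
    by_cases g1 : v = x₁
    · subst g1; simp [hx, f1, f2]; omega
    · by_cases g2 : v = x₂
      · subst g2; simp [g1, f3, f4]; omega
      · by_cases g3 : v = y₁
        · subst g3; simp [g1, g2, hy]; omega
        · by_cases g4 : v = y₂
          · subst g4; simp [g1, g2, g3]; omega
          · simp only [g1, g2, g3, g4, if_false]; omega
  · intro v hva hvb
    rw [hd, if_neg (by rintro rfl; exact hvb hx1), if_neg (by rintro rfl; exact hvb hx2),
      if_neg (by rintro rfl; exact hva hy1), if_neg (by rintro rfl; exact hva hy2)]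
    omega

/-- Otherwise `pq` and `p'q'` could both be rerouted through the untouched component of `b`,
entering at `x₁` and leaving at `x₂`, each of which rises to degree four. -/
theorem no_double_triangle (c : Unmergeable G H a b) {x₁ x₂ p q p' q' : V}
    (hx1 : H.Reachable b x₁) (hx2 : H.Reachable b x₂) (hp : H.Reachable a p)
    (hp' : H.Reachable a p') (hx : x₁ ≠ x₂) (dx1 : H.deg x₁ = 2) (dx2 : H.deg x₂ = 2)
    (hpq : H.Adj p q) (hpq' : H.Adj p' q') (hpp : p ≠ p') (hqq : q ≠ q') (hpq1 : p ≠ q')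
    (h1 : G.Adj x₁ p) (h2 : G.Adj x₁ p') (h3 : G.Adj x₂ q) (h4 : G.Adj x₂ q') : False := by
  classical
  have hq : H.Reachable a q := hp.trans hpq.reachable
  have hq' : H.Reachable a q' := hp'.trans hpq'.reachable
  have e1 := hpq.ne
  have e2 := hpq'.ne
  have n1 := c.not_adj hx1 hp
  have n2 := c.not_adj hx1 hp'
  have n3 := c.not_adj hx2 hq
  have n4 := c.not_adj hx2 hq'
  have f1 := c.ne hx1 hp
  have f2 := c.ne hx1 hp'
  have f3 := c.ne hx2 hq
  have f4 := c.ne hx2 hq'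
  have f5 := c.ne hx1 hq
  have f6 := c.ne hx1 hq'
  have f7 := c.ne hx2 hp
  have f8 := c.ne hx2 hp'
  set J := (H \ edge p q) \ edge p' q' with hJ
  set K := ((J ⊔ edge x₁ p) ⊔ edge x₁ p') ⊔ edge x₂ q with hK
  have hpq'' : (H \ edge p q).Adj p' q' := ⟨hpq', by rw [edge_adj]; grind⟩
  have hd : ∀ v, (K ⊔ edge x₂ q').deg v = H.deg v + 2 * (if v = x₁ then 1 else 0)
      + 2 * (if v = x₂ then 1 else 0) := by
    intro v
    have d0 := deg_sdiff_edge hpq v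
    have d0' := deg_sdiff_edge hpq'' v
    rw [← hJ] at d0'
    have d1 := deg_sup_edge (H := J) f1 (by simp [hJ, n1]) v
    have d2 := deg_sup_edge (H := J ⊔ edge x₁ p) f2 (by simp [hJ, n2, edge_adj]; grind) v
    have d3 := deg_sup_edge (H := (J ⊔ edge x₁ p) ⊔ edge x₁ p') f3
      (by simp [hJ, n3, edge_adj]; grind) v
    rw [← hK] at d3
    have d4 := deg_sup_edge (H := K) f4 (by simp [hK, hJ, n4, edge_adj]; grind) v
    omega
  have r1 : (K ⊔ edge x₂ q').Adj x₁ p := by simp [hK, edge_adj, f1]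
  have r2 : (K ⊔ edge x₂ q').Adj x₁ p' := by simp [hK, edge_adj, f2]
  have r3 : (K ⊔ edge x₂ q').Adj x₂ q := by simp [hK, edge_adj, f3]
  have r4 : (K ⊔ edge x₂ q').Adj x₂ q' := by simp [edge_adj, f4]
  have hle : J ≤ K ⊔ edge x₂ q' :=
    ((le_sup_left.trans le_sup_left).trans le_sup_left).trans le_sup_left
  have r0 : (K ⊔ edge x₂ q').Reachable x₁ x₂ := by
    refine (hx1.symm.trans hx2).lift_on fun u v hu huv => ?_
    have hu' : H.Reachable b u := hx1.trans hu
    have g1 := c.ne hu' hp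
    have g2 := c.ne hu' hq
    have g3 := c.ne hu' hp'
    have g4 := c.ne hu' hq'
    refine Adj.reachable (hle ⟨⟨huv, ?_⟩, ?_⟩) <;> rw [edge_adj] <;> grind
  have s1 := (r1.symm.reachable.trans r0).trans r3.reachable
  have s2 := (r2.symm.reachable.trans r0).trans r4.reachable
  refine c.elim (H' := K ⊔ edge x₂ q')
    (sup_le (sup_le (sup_le (sup_le ((sdiff_le.trans sdiff_le).trans c.le)
      ((edge_le_iff _).2 (Or.inr h1)))
      ((edge_le_iff _).2 (Or.inr h2))) ((edge_le_iff _).2 (Or.inr h3)))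
      ((edge_le_iff _).2 (Or.inr h4))) ?_ ?_ ?_ hx1 hp r1.reachable
  · intro v
    rw [hd]
    have := c.deg v
    by_cases g1 : v = x₁
    · subst g1; simp [hx]; omega
    · by_cases g2 : v = x₂
      · subst g2; simp [g1]; omega
      · simp only [g1, g2, if_false]; omega
  · intro v hva hvb
    rw [hd, if_neg (by rintro rfl; exact hvb hx1), if_neg (by rintro rfl; exact hvb hx2)]
    omega
  · intro u v huv
    by_cases he : (edge p q).Adj u v
    · rw [edge_adj] at he
      rcases he.1 with ⟨rfl, rfl⟩ | ⟨rfl, rfl⟩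
      exacts [s1, s1.symm]
    · by_cases he' : (edge p' q').Adj u v
      · rw [edge_adj] at he'
        rcases he'.1 with ⟨rfl, rfl⟩ | ⟨rfl, rfl⟩
        exacts [s2, s2.symm]
      · exact Adj.reachable (hle ⟨⟨huv, he⟩, he'⟩)

end Unmergeable

end Merging

end SimpleGraph

namespace SimpleGraph

/-! ### Alternation along components and the final contradiction -/

section Closing

variable {V : Type*} {G H : SimpleGraph V} {a b : V}

theorem exists_adj_ne [Finite V] {v : V} (h : 2 ≤ H.deg v) (w : V) : ∃ z, H.Adj v z ∧ z ≠ w := by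
  obtain ⟨z, hz, hne⟩ := Set.exists_ne_of_one_lt_ncard (s := H.neighborSet v) h w
  exact ⟨z, hz, hne⟩

namespace Unmergeable

theorem two_le_deg (c : Unmergeable G H a b) (v : V) : 2 ≤ H.deg v := by
  rcases c.deg v with h | h <;> omega

theorem exists_cross_adj (c : Unmergeable G H a b) {x₁ x₂ y₁ y₂ : V} (hx : H.Reachable b x₁)
    (hxx : H.Adj x₁ x₂) (hy : H.Reachable a y₁) (hyy : G.Adj y₁ y₂) (hy2 : H.Reachable a y₂) :
    G.Adj x₁ y₁ ∨ G.Adj x₁ y₂ ∨ G.Adj x₂ y₁ ∨ G.Adj x₂ y₂ :=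
  c.free.exists_adj (c.le hxx) hyy (c.ne hx hy) (c.ne hx hy2) (c.ne (hx.trans hxx.reachable) hy)
    (c.ne (hx.trans hxx.reachable) hy2)

variable [Finite V]

/-- The neighbors of the ends of an edge alternate along the edges of the other component. -/
theorem adj_or_adj_iff_not (c : Unmergeable G H a b) {x₁ x₂ y₁ y₂ : V} (hx : H.Reachable b x₁)
    (hxx : H.Adj x₁ x₂) (d1 : H.deg x₁ = 2) (d2 : H.deg x₂ = 2) (hy : H.Reachable a y₁)
    (hyy : H.Adj y₁ y₂) : (G.Adj x₁ y₁ ∨ G.Adj x₂ y₁) ↔ ¬ (G.Adj x₁ y₂ ∨ G.Adj x₂ y₂) := by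
  have hx2 := hx.trans hxx.reachable
  have hy2 := hy.trans hyy.reachable
  constructor
  · rintro (h1 | h1) (h2 | h2)
    · exact c.no_triangle hx d1 hy hyy h1 h2
    · exact c.no_parallel hx hxx hy hyy h1 h2
    · exact c.no_parallel hx hxx hy2 hyy.symm h2 h1
    · exact c.no_triangle hx2 d2 hy hyy h1 h2
  · intro h
    -- The exchanges forbid that both ends are attached; `2K₂`-freeness forbids that neither is.
    have := c.exists_cross_adj hx hxx hy (c.le hyy) hy2
    tauto

/-- If `q` were not attached to `x₁x₂`, alternation would attach all its `H`-neighbors, and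
splitting off two edges at `q` would merge the components. -/
theorem adj_or_adj_of_deg_eq_four (c : Unmergeable G H a b) {x₁ x₂ q : V} (hx : H.Reachable b x₁)
    (hxx : H.Adj x₁ x₂) (d1 : H.deg x₁ = 2) (d2 : H.deg x₂ = 2) (hq : H.Reachable a q)
    (hq4 : H.deg q = 4) : G.Adj x₁ q ∨ G.Adj x₂ q := by
  by_contra hcon
  obtain ⟨p₁, p₂, hne, h1, h2, hr⟩ := exists_split_of_deg_eq_four c.even_deg hq4
  have hx2 := hx.trans hxx.reachable
  have hp : ∀ p, H.Adj q p → G.Adj x₁ p ∨ G.Adj x₂ p := by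
    intro p hp
    have := c.adj_or_adj_iff_not hx hxx d1 d2 hq hp
    tauto
  rcases hp p₁ h1 with g1 | g1 <;> rcases hp p₂ h2 with g2 | g2
  · exact c.no_split_same hx d1 hq hq4 hne h1 h2 hr g1 g2
  · exact c.no_split_cross hx hxx hq hq4 hne h1 h2 hr g1 g2
  · exact c.no_split_cross hx2 hxx.symm hq hq4 hne h1 h2 hr g1 g2
  · exact c.no_split_same hx2 d2 hq hq4 hne h1 h2 hr g1 g2

/-- If `z` had no neighbor across, each of its two cycle neighbors would alternate along the other
cycle on its own. Two equal patterns give a square, two opposite ones a double triangle. -/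
theorem exists_adj_of_deg_eq_two (c : Unmergeable G H a b)
    (ha : ∀ v, H.Reachable a v → H.deg v = 2) (hb : ∀ v, H.Reachable b v → H.deg v = 2) {z : V}
    (hz : H.Reachable b z) : ∃ y, H.Reachable a y ∧ G.Adj z y := by
  by_contra! hcon
  obtain ⟨x₁, hx₁, -⟩ := exists_adj_ne (c.two_le_deg z) z
  obtain ⟨x₂, hx₂, hne⟩ := exists_adj_ne (c.two_le_deg z) x₁
  have rx₁ := hz.trans hx₁.reachable
  have rx₂ := hz.trans hx₂.reachable
  have hflip : ∀ x, H.Adj z x → ∀ u v, H.Reachable a u → H.Adj u v →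
      (G.Adj x u ↔ ¬ G.Adj x v) := by
    intro x hx u v hu huv
    have h1 := c.adj_or_adj_iff_not hz hx (hb z hz) (hb x (hz.trans hx.reachable)) hu huv
    have h2 := hcon u hu
    have h3 := hcon v (hu.trans huv.reachable)
    tauto
  have hA := hflip x₁ hx₁
  have hB := hflip x₂ hx₂
  obtain ⟨q, hq, hqA⟩ : ∃ q, H.Reachable a q ∧ ¬ G.Adj x₁ q := by
    by_cases h : G.Adj x₁ a
    · obtain ⟨a', ha', -⟩ := exists_adj_ne (c.two_le_deg a) a
      exact ⟨a', ha'.reachable, (hA a a' (Reachable.refl a) ha').1 h⟩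
    · exact ⟨a, Reachable.refl a, h⟩
  obtain ⟨p, hp, -⟩ := exists_adj_ne (c.two_le_deg q) q
  obtain ⟨p', hp', hpp⟩ := exists_adj_ne (c.two_le_deg q) p
  have rp := hq.trans hp.reachable
  have rp' := hq.trans hp'.reachable
  have hpA : G.Adj x₁ p := by have := hA q p hq hp; tauto
  have hpA' : G.Adj x₁ p' := by have := hA q p' hq hp'; tauto
  by_cases hqB : G.Adj x₂ q
  · obtain ⟨q', hq', hqq⟩ := exists_adj_ne (c.two_le_deg p') q
    have hpB : ¬ G.Adj x₂ p := (hB q p hq hp).1 hqB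
    have hpB' : ¬ G.Adj x₂ p' := (hB q p' hq hp').1 hqB
    have hqB' : G.Adj x₂ q' := by have := hB p' q' rp' hq'; tauto
    exact c.no_double_triangle rx₁ rx₂ rp rp' hne.symm (hb _ rx₁) (hb _ rx₂) hp.symm hq'
      hpp.symm hqq.symm (by rintro rfl; exact hpB hqB') hpA hpA' hqB hqB'
  · have hpB : G.Adj x₂ p := by have := hB q p hq hp; tauto
    have hpB' : G.Adj x₂ p' := by have := hB q p' hq hp'; tauto
    exact c.no_square rx₁ rx₂ rp rp' hne.symm hpp.symm (hb _ rx₁) (hb _ rx₂) (ha _ rp)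
      (ha _ rp') hpA hpA' hpB hpB'

/-- Two `2`-regular components can be merged. -/
theorem false_of_deg_eq_two (c : Unmergeable G H a b)
    (ha : ∀ v, H.Reachable a v → H.deg v = 2) (hb : ∀ v, H.Reachable b v → H.deg v = 2) :
    False := by
  obtain ⟨b', hb', -⟩ := exists_adj_ne (c.two_le_deg b) b
  have rb : H.Reachable b b := Reachable.refl b
  obtain ⟨y, hy, hby⟩ := c.exists_adj_of_deg_eq_two ha hb rb
  obtain ⟨y', hy', hby'⟩ := c.exists_adj_of_deg_eq_two ha hb hb'.reachable
  have hflip : ∀ u v, H.Reachable a u → H.Adj u v →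
      ((G.Adj b u ∨ G.Adj b' u) ↔ ¬ (G.Adj b v ∨ G.Adj b' v)) := fun u v hu huv =>
    c.adj_or_adj_iff_not rb hb' (hb b rb) (hb b' hb'.reachable) hu huv
  have hflip' : ∀ y₁ y₂, H.Reachable a y₁ → H.Adj y₁ y₂ → ∀ u v, H.Reachable b u → H.Adj u v →
      ((G.Adj y₁ u ∨ G.Adj y₂ u) ↔ ¬ (G.Adj y₁ v ∨ G.Adj y₂ v)) := fun y₁ y₂ hy hyy u v hu huv =>
    c.symm.adj_or_adj_iff_not hy hyy (ha _ hy) (ha _ (hy.trans hyy.reachable)) hu huv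
  -- If `b` were adjacent to `u` but not to `p`, the neighborhoods of `uv` and `vp`, both
  -- alternating along the component of `b`, would disagree at `b` yet agree at a neighbor `s` of
  -- `v`.
  have hstep : ∀ u v, H.Reachable a u → H.Adj u v → G.Adj b u →
      ∀ p, H.Adj v p → G.Adj b p := by
    intro u v hu huv hbu p hvp
    by_contra hbp
    have hv := hu.trans huv.reachable
    have hnv := (hflip u v hu huv).1 (Or.inl hbu)
    have hb'p : G.Adj b' p := by
      have := hflip v p hv hvp
      tauto
    obtain ⟨s, hs, hvs⟩ := c.symm.exists_adj_of_deg_eq_two hb ha hv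
    have h1 := Reachable.iff_iff_of_alternating (H := H) (y := b) (z := s)
      (A := fun s => G.Adj u s ∨ G.Adj v s) (B := fun s => G.Adj v s ∨ G.Adj p s) hs
      (hflip' u v hu huv) (hflip' v p hv hvp)
    simp only [G.adj_comm _ b] at h1
    tauto
  -- Hence every vertex across is adjacent to `b` or to neither end of `bb'`. The neighbor `y'` of
  -- `b'` must then be adjacent to both, a triangle.
  have hall : ∀ {u z : V} (w : H.Walk u z), H.Reachable a u →
      (G.Adj b u ∨ (¬ (G.Adj b u ∨ G.Adj b' u) ∧ ∀ p, H.Adj u p → G.Adj b p)) →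
      (G.Adj b z ∨ (¬ (G.Adj b z ∨ G.Adj b' z) ∧ ∀ p, H.Adj z p → G.Adj b p)) := by
    intro u z w
    induction w with
    | nil => exact fun _ h => h
    | cons huv w ih =>
      intro hu hlab
      refine ih (hu.trans huv.reachable) ?_
      rcases hlab with h | ⟨-, h⟩
      · exact Or.inr ⟨(hflip _ _ hu huv).1 (Or.inl h), hstep _ _ hu huv h⟩
      · exact Or.inl (h _ huv)
  obtain ⟨w⟩ := hy.symm.trans hy'
  rcases hall w hy (Or.inl hby) with h | ⟨h, -⟩
  · exact c.symm.no_triangle hy' (ha _ hy') rb hb' h.symm hby'.symm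
  · exact h (Or.inr hby')

end Unmergeable

/-- If some vertex of the component of `a` has degree four, some other component can be merged
with it. -/
theorem IsTough.exists_not_unmergeable [Fintype V] (htough : G.IsTough (3 / 2))
    (hout : ∀ v, ¬ H.Reachable a v → H.deg v = 2) {z c₀ : V} (hz : H.Reachable a z)
    (hz4 : H.deg z = 4) (hc₀ : ¬ H.Reachable a c₀) :
    ∃ c, ¬ H.Reachable a c ∧ ¬ Unmergeable G H a c := by
  classical
  by_contra! hcon
  have hc := hcon c₀ hc₀
  obtain ⟨c₁, hc₁, -⟩ := exists_adj_ne (hc.two_le_deg c₀) c₀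
  have hnr : ∀ {x x'}, ¬ H.Reachable a x → H.Adj x x' → ¬ H.Reachable a x' :=
    fun hx hxx h => hx (h.trans hxx.symm.reachable)
  have hflip : ∀ x x', ¬ H.Reachable a x → H.Adj x x' → ∀ u v, H.Reachable a u → H.Adj u v →
      ((G.Adj x u ∨ G.Adj x' u) ↔ ¬ (G.Adj x v ∨ G.Adj x' v)) := fun x x' hx hxx u v hu huv =>
    (hcon x hx).adj_or_adj_iff_not (Reachable.refl x) hxx (hout x hx) (hout x' (hnr hx hxx)) hu huv
  have hfour : ∀ x x', ¬ H.Reachable a x → H.Adj x x' → ∀ q, H.Reachable a q → H.deg q = 4 →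
      G.Adj x q ∨ G.Adj x' q := fun x x' hx hxx q hq hq4 =>
    (hcon x hx).adj_or_adj_of_deg_eq_four (Reachable.refl x) hxx (hout x hx)
      (hout x' (hnr hx hxx)) hq hq4
  -- All outside edges attach to `z`, and alternating patterns that agree at one vertex agree on the
  -- whole component.
  have hsame : ∀ x x', ¬ H.Reachable a x → H.Adj x x' → ∀ y, H.Reachable a y →
      ((G.Adj x y ∨ G.Adj x' y) ↔ (G.Adj c₀ y ∨ G.Adj c₁ y)) := by
    intro x x' hx hxx y hy
    refine (Reachable.iff_iff_of_alternating (H := H) (A := fun y => G.Adj x y ∨ G.Adj x' y)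
      (B := fun y => G.Adj c₀ y ∨ G.Adj c₁ y) (hz.symm.trans hy)
      (fun u v hu => hflip x x' hx hxx u v (hz.trans hu))
      (fun u v hu => hflip c₀ c₁ hc₀ hc₁ u v (hz.trans hu))).1 ?_
    exact iff_of_true (hfour x x' hx hxx z hz hz4) (hfour c₀ c₁ hc₀ hc₁ z hz hz4)
  let P : Finset V := Finset.univ.filter fun y => H.Reachable a y ∧ (G.Adj c₀ y ∨ G.Adj c₁ y)
  let Q : Finset V := Finset.univ.filter fun y => H.Reachable a y ∧ ¬ (G.Adj c₀ y ∨ G.Adj c₁ y)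
  have hP : ∀ y, y ∈ P ↔ H.Reachable a y ∧ (G.Adj c₀ y ∨ G.Adj c₁ y) := by simp [P]
  have hQ : ∀ y, y ∈ Q ↔ H.Reachable a y ∧ ¬ (G.Adj c₀ y ∨ G.Adj c₁ y) := by simp [Q]
  have hnbr : ∀ v, (Finset.univ.filter (H.Adj v)).card = H.deg v := by
    intro v
    rw [deg, Set.ncard_eq_toFinset_card']
    congr 1
    ext w; simp
  -- Count `H`-edges between `P` and `Q`: all degree-four vertices lie in `P`, so each vertex of `Q`
  -- has degree exactly two.
  have hPQ : P.card * 2 ≤ Q.card * 2 := by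
    refine Finset.card_mul_le_card_mul H.Adj (fun p hp => ?_) (fun q hq => ?_)
    · rw [hP] at hp
      rw [Finset.bipartiteAbove]
      refine (hc.two_le_deg p).trans ?_
      rw [← hnbr]
      refine Finset.card_le_card fun q hq => ?_
      simp only [Finset.mem_filter, Finset.mem_univ, true_and] at hq
      rw [Finset.mem_filter, hQ]
      exact ⟨⟨hp.1.trans hq.reachable, (hflip c₀ c₁ hc₀ hc₁ p q hp.1 hq).1 hp.2⟩, hq⟩
    · rw [hQ] at hq
      rw [Finset.bipartiteBelow]
      have h2 : H.deg q = 2 := by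
        rcases hc.deg q with h | h
        · exact h
        · exact absurd (hfour c₀ c₁ hc₀ hc₁ q hq.1 h) hq.2
      rw [← h2, ← hnbr]
      refine Finset.card_le_card fun p hp => ?_
      simp only [Finset.mem_filter, Finset.mem_univ, true_and] at hp ⊢
      exact hp.2.symm
  obtain ⟨q, hzq, -⟩ := exists_adj_ne (hc.two_le_deg z) z
  have hqQ : q ∈ Q := (hQ q).2 ⟨hz.trans hzq.reachable,
    (hflip c₀ c₁ hc₀ hc₁ z q hz hzq).1 (hfour c₀ c₁ hc₀ hc₁ z hz hz4)⟩
  -- A `G`-edge inside `Q` would form a `2K₂` with `c₀c₁`, and an edge leaving the component would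
  -- put its end in `P`. So deleting `P` isolates `Q`, with `c₀` in a further component.
  have := htough.three_mul_le (S := P) (A := Q) (z := c₀) ⟨q, hqQ⟩
    (fun y hy hyP => ((hQ y).1 hy).2 ((hP y).1 hyP).2) (fun y hy w hyw => by
      rw [hQ] at hy
      by_cases hw : H.Reachable a w
      · rw [hP]
        refine ⟨hw, ?_⟩
        have := hc.exists_cross_adj (Reachable.refl c₀) hc₁ hy.1 hyw hw
        tauto
      · obtain ⟨w', hw', -⟩ := exists_adj_ne (hc.two_le_deg w) w
        exact absurd ((hsame w w' hw hw' y hy.1).1 (Or.inl hyw.symm)) hy.2)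
    (fun h => hc₀ ((hQ _).1 h).1) (fun h => hc₀ ((hP _).1 h).1)
  omega

/-- A `3/2`-tough `2K₂`-free graph with a `2`-factor has a connected spanning subgraph with all
degrees two or four. -/
theorem IsTough.exists_connected_of_two_factor [Fintype V] [Nonempty V]
    (htough : G.IsTough (3 / 2)) (hfree : G.IsTwoKTwoFree) {F : SimpleGraph V} (hF : F ≤ G)
    (hF2 : ∀ v, F.deg v = 2) : ∃ H ≤ G, H.Connected ∧ ∀ v, H.deg v = 2 ∨ H.deg v = 4 := by
  classical
  -- Vertices of degree four are confined to the component of the marked vertex, whose size is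
  -- maximized.
  let S : Set (SimpleGraph V × V) := {s | s.1 ≤ G ∧ (∀ v, s.1.deg v = 2 ∨ s.1.deg v = 4) ∧
    ∀ v, ¬ s.1.Reachable s.2 v → s.1.deg v = 2}
  obtain ⟨⟨H, a⟩, ⟨hle, hdeg, hout⟩, hmax⟩ := Set.exists_max_image S
    (fun s => {v | s.1.Reachable s.2 v}.ncard) (Set.toFinite S)
    ⟨(F, Classical.arbitrary V), hF, fun v => Or.inl (hF2 v), fun v _ => hF2 v⟩
  simp only at hle hdeg hout hmax
  have hun : ∀ c, ¬ H.Reachable a c → Unmergeable G H a c := by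
    intro c hc
    refine ⟨hfree, hle, hdeg, hc, fun H' hle' hdeg' hoff hlift hac => ?_⟩
    have hsub : ∀ v, H.Reachable a v → H'.Reachable a v :=
      fun v hv => hv.lift_on fun x y _ => hlift x y
    have hsubc : ∀ v, H.Reachable c v → H'.Reachable a v :=
      fun v hv => hac.trans (hv.lift_on fun x y _ => hlift x y)
    have h1 := hmax (H', a) ⟨hle', hdeg', fun v hv => by
      have h2 : ¬ H.Reachable a v := fun h => hv (hsub v h)
      exact (hoff v h2 fun h => hv (hsubc v h)).trans (hout v h2)⟩
    have h2 : {v | H.Reachable a v} ⊂ {v | H'.Reachable a v} :=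
      ⟨hsub, fun h => hc (h hac)⟩
    exact absurd (Set.ncard_lt_ncard h2 (Set.toFinite _)) (not_lt.2 h1)
  refine ⟨H, hle, ?_, hdeg⟩
  rw [connected_iff_exists_forall_reachable]
  refine ⟨a, ?_⟩
  by_contra! hcon
  obtain ⟨c, hc⟩ := hcon
  by_cases h4 : ∃ z, H.Reachable a z ∧ H.deg z = 4
  · obtain ⟨z, hz, hz4⟩ := h4
    obtain ⟨c', hc', hnot⟩ := htough.exists_not_unmergeable (G := G) hout hz hz4 hc
    exact hnot (hun c' hc')
  · push Not at h4
    exact (hun c hc).false_of_deg_eq_two (fun v hv => (hdeg v).resolve_right (h4 v hv))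
      fun v hv => hout v fun h => hc (h.trans hv.symm)

end Closing

end SimpleGraph

theorem theorem1p4 {V : Type*} [Finite V] (G : SimpleGraph V)
    (hcard : 3 ≤ Nat.card V) (htough : G.IsTough (3 / 2)) (hfree : G.IsTwoKTwoFree) :
    G.HasSpanningKTrail 2 ∧
      ∃ H : SimpleGraph V, H.IsSpanningEulerianSubgraph G ∧
        ∀ v : V, (H.neighborSet v).ncard ≤ 4 := by
  have := Fintype.ofFinite V
  rw [Nat.card_eq_fintype_card] at hcard
  have : Nonempty V := Fintype.card_pos_iff.1 (by omega)
  obtain ⟨F, hF, hF2⟩ := htough.exists_two_factor hfree hcard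
  obtain ⟨H, hle, hconn, hdeg⟩ := htough.exists_connected_of_two_factor hfree hF hF2
  have heven : ∀ v, Even (H.deg v) := by
    intro v
    rcases hdeg v with h | h <;> rw [h] <;> decide
  have hle4 : ∀ v, H.deg v ≤ 4 := by
    intro v
    have := hdeg v
    omega
  refine ⟨SimpleGraph.hasSpanningKTrail_of_le hle hconn heven hle4 fun v => ?_,
    H, ⟨hle, hconn, heven⟩, hle4⟩
  have := hdeg v
  omega
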